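/- Let $n\ge 2$, $m\ge 0$, and let $\mathcal G=(\{1,\dots,n\},\mathcal E)$ be a strongly connected directed graph with $(i,i)\in\mathcal E$ for all $i$, where $(j,i)\in\mathcal E$ means that $j$ sends information to $i$. Let $W_r$ and $W_c$ be nonnegative $n\times n$ matrices with $[W_r]_{ij}>0\iff (j,i)\in\mathcal E$ and $[W_c]_{ij}>0\iff (j,i)\in\mathcal E$, such that every row of $W_r$ and every column of $W_c$ sums to $1$. Let $f_1,\dots,f_n:\mathbb R^m\to\mathbb R$ be functions, possibly non-convex, whose sum $f=\sum_i f_i$ is convex and for which there is $\hat D>0$ with $|f_i(x)-f_i(y)|\le\hat D\|x-y\|$ for all $i,x,y$. Let $\mu>0$, and let $\alpha_k\ge 0$ satisfy $\sum_{k\ge0}\alpha_k=\infty$ and $\sum_{k\ge0}\alpha_k^2<\infty$. Let $$0<\epsilon<\bar\epsilon:=\frac{(1-|\lambda_3|)^n}{(20+8n)^n},$$ where $\lambda_3$ is the third largest eigenvalue, in modulus and counted with algebraic multiplicity, of the $2n\times 2n$ matrix $\begin{bmatrix} W_r & 0\\ I-W_r & W_c\end{bmatrix}$. Let $\zeta^i_k$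 ($k\ge 0$, $1\le i\le n$) be standard Gaussian random vectors in $\mathbb R^m$ on a common probability space; no independence between them is needed. From arbitrary deterministic $x^i_0,y^i_0\in\mathbb R^m$ define, for $k\ge 0$, $$x^i_{k+1}=\sum_{j=1}^n[W_r]_{ij}x^j_k+\epsilon y^i_k-\alpha_k\,\frac{f_i(x^i_k+\mu\zeta^i_k)-f_i(x^i_k)}{\mu}\,\zeta^i_k,$$ $$y^i_{k+1}=x^i_k-\sum_{j=1}^n[W_r]_{ij}x^j_k+\sum_{j=1}^n[W_c]_{ij}y^j_k-\epsilon y^i_k,$$ and put $\bar\theta_k=\frac1n\sum_{i=1}^n x^i_k+\frac1n\sum_{i=1}^n y^i_k$. Then: 1. $\sum_{k}\alpha_k\sum_{i=1}^n\|x^i_k-\bar\theta_k\|<\infty$ almost surely; 2. for every $i$, $x^i_k-\bar\theta_k\to 0$ as $k\to\infty$ almost surely, and in mean: each $x^i_k-\bar\theta_k$ is integrable and $\mathbf E\|x^i_k-\bar\theta_k\|\to 0$. -/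

import Mathlib

open MeasureTheory ProbabilityTheory Filter Topology

namespace GradFreeDGD

/-- Strong connectivity: there is a directed path from every vertex to every vertex. -/
def StronglyConnected {V : Type*} (G : Digraph V) : Prop :=
  ∀ i j : V, Relation.ReflTransGen G.Adj i j

/-- `W` is a nonnegative weight matrix on the network `G`: `W i j`, the weight that agent `i`
gives to the information sent by agent `j`, is positive exactly when `j → i` is an edge, and it is
zero otherwise. -/
def IsWeightMatrix {n : ℕ} (G : Digraph (Fin n)) (W : Matrix (Fin n) (Fin n) ℝ) : Prop :=
  (∀ i j, 0 ≤ W i j) ∧ ∀ i j, 0 < W i j ↔ G.Adj j i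

/-- Every row sums to one. -/
def RowSumsOne {n : ℕ} (W : Matrix (Fin n) (Fin n) ℝ) : Prop :=
  ∀ i, ∑ j, W i j = 1

/-- Every column sums to one. -/
def ColSumsOne {n : ℕ} (W : Matrix (Fin n) (Fin n) ℝ) : Prop :=
  ∀ j, ∑ i, W i j = 1

/-- The `2n × 2n` matrix `[W_r, ε I; I - W_r, W_c - ε I]`. -/
def augmented {n : ℕ} (Wr Wc : Matrix (Fin n) (Fin n) ℝ) (ε : ℝ) :
    Matrix (Fin n ⊕ Fin n) (Fin n ⊕ Fin n) ℝ :=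
  Matrix.fromBlocks Wr (ε • (1 : Matrix (Fin n) (Fin n) ℝ)) (1 - Wr)
    (Wc - ε • (1 : Matrix (Fin n) (Fin n) ℝ))

/-- The moduli of the complex eigenvalues of a real square matrix, repeated according to algebraic
multiplicity, in decreasing order. -/
noncomputable def eigenvalueModuli {ι : Type*} [Fintype ι] [DecidableEq ι]
    (M : Matrix ι ι ℝ) : List ℝ :=
  ((M.map (algebraMap ℝ ℂ)).charpoly.roots.map (fun z : ℂ => ‖z‖)).sort (· ≥ ·)

/-- `|λ₃|`, the modulus of the third largest eigenvalue (in modulus, with multiplicity).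
It is meaningful for matrices of size at least three; the default value `0` is not used then. -/
noncomputable def thirdModulus {ι : Type*} [Fintype ι] [DecidableEq ι]
    (M : Matrix ι ι ℝ) : ℝ :=
  (eigenvalueModuli M).getD 2 0

/-- `(1 - |λ₃|)^n / (20 + 8 n)^n`, where `λ₃` is the third largest eigenvalue of the augmented
matrix at `ε = 0`. -/
noncomputable def epsBar {n : ℕ} (Wr Wc : Matrix (Fin n) (Fin n) ℝ) : ℝ :=
  1 / (20 + 8 * (n : ℝ)) ^ n * (1 - thirdModulus (augmented Wr Wc 0)) ^ n

/-- The randomized gradient-free oracle with smoothing parameter `μ` and direction `z`. -/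
noncomputable def oracle {m : ℕ} (f : EuclideanSpace ℝ (Fin m) → ℝ) (μ : ℝ)
    (x z : EuclideanSpace ℝ (Fin m)) : EuclideanSpace ℝ (Fin m) :=
  ((f (x + μ • z) - f x) / μ) • z

/-- The pair of families `(x_k, y_k)` produced by the update law from the initial values `x0`, `y0`,
along one realisation `z k i` of the random directions. -/
noncomputable def iter {n m : ℕ} (Wr Wc : Matrix (Fin n) (Fin n) ℝ) (ε : ℝ) (α : ℕ → ℝ) (μ : ℝ)
    (f : Fin n → EuclideanSpace ℝ (Fin m) → ℝ) (x0 y0 : Fin n → EuclideanSpace ℝ (Fin m))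
    (z : ℕ → Fin n → EuclideanSpace ℝ (Fin m)) :
    ℕ → (Fin n → EuclideanSpace ℝ (Fin m)) × (Fin n → EuclideanSpace ℝ (Fin m))
  | 0 => (x0, y0)
  | k + 1 =>
    let x := (iter Wr Wc ε α μ f x0 y0 z k).1
    let y := (iter Wr Wc ε α μ f x0 y0 z k).2
    (fun i => ∑ j, Wr i j • x j + ε • y i - α k • oracle (f i) μ (x i) (z k i),
     fun i => x i - ∑ j, Wr i j • x j + ∑ j, Wc i j • y j - ε • y i)

/-- The network average `(1/n) ∑ x^i + (1/n) ∑ y^i` of a state `(x, y)`. -/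
noncomputable def average {n m : ℕ}
    (s : (Fin n → EuclideanSpace ℝ (Fin m)) × (Fin n → EuclideanSpace ℝ (Fin m))) :
    EuclideanSpace ℝ (Fin m) :=
  (1 / (n : ℝ)) • ∑ i, s.1 i + (1 / (n : ℝ)) • ∑ i, s.2 i

/-- The consensus error `x^i - θ̄` of agent `i` in a state `(x, y)`. -/
noncomputable def consensusError {n m : ℕ}
    (s : (Fin n → EuclideanSpace ℝ (Fin m)) × (Fin n → EuclideanSpace ℝ (Fin m))) (i : Fin n) :
    EuclideanSpace ℝ (Fin m) :=
  s.1 i - average s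

end GradFreeDGD

/-!
The states `(x, y)` evolve by the augmented matrix `M = [W_r, ε I; I - W_r, W_c - ε I]`, perturbed in
each step by `α k` times the oracle directions. Removing from `M` its spectral projection for the
eigenvalue `1` (`consensusProj`) leaves a matrix `B` (`deflated`) that governs the deviation from the
network average (`deviation_iter_succ`). The proof has two parts.

*All eigenvalues of `B` lie in the open unit disc* (`deflated_eigenvector_eq_zero`). An eigenvalue
`z ≠ 1` of `M` makes `(z - W_r)(z - W_c) + ε (z - 1)` singular. Let `δ = 1 - |λ₃|`. The matrices
`W_r` and `W_c` are contractions, in the sup norm and the `ℓ¹` norm, and off their Perron vectors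
their spectra lie in the disc of radius `1 - δ`; hence for `‖z‖ ≥ 1` their resolvents there are
bounded by `3 ^ (n - 1) / (‖z‖ - 1 + δ)` (`resolvent_bound`, by removing the eigenvalues one at a
time with Blaschke factors). Only the first power of the gap occurs for each resolvent, so the bound
on `ε` is more than enough to reduce the singularity to a scalar relation along the Perron vectors:
`z - 1` equals `-q`, where `q = ε n (π_r ⬝ π_c) > 0`, up to an error of at most `(q + ‖z - 1‖) / 4`
(`eq_zero_of_pencil`, `perturbation_estimate`). This is impossible for `‖z‖ ≥ 1`. It is essential
that the error is relative to `q`, since `π_r ⬝ π_c` has no lower bound in terms of `n` and `δ`.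
At `z = 1` the Perron vectors alone suffice. The positivity of `δ` is contained in the hypothesis
that the range of `ε` is nonempty.

*Stability of a driven geometric recursion.* By Gelfand's formula the powers of `B` decay like
`ρ ^ k` with `ρ < 1`, and the oracle is bounded by a constant times `‖ζ‖ ^ 2`. So the consensus
errors are dominated, along every realisation, by the solution of `u (k + 1) = ρ u k + b k`, with
`b k` a multiple of `α k * ∑ i, ‖ζ k i‖ ^ 2` (`exists_norm_consensusError_le`). A square summable `b`
gives a square summable `u` (`summable_scalarRec_sq`), thus `∑ α k * u k < ∞` and `u → 0`. This is
applied twice: almost surely, where `∑ b k ^ 2 < ∞` because Gaussian fourth moments are finite, and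
to the expectations, where `∫ b k` is a constant times `α k`. No independence enters.
-/

namespace GradFreeDGD

/-! ### Resolvents of contractions with spectrum in a smaller disc -/

section Resolvent

variable {E : Type*} [NormedAddCommGroup E] [NormedSpace ℂ E]

theorem one_sub_norm_mul_norm_le {A : E →ₗ[ℂ] E} (hA : ∀ v, ‖A v‖ ≤ ‖v‖) (a : ℂ) (h : E) :
    (1 - ‖a‖) * ‖h‖ ≤ ‖h - a • A h‖ := by
  have h1 : ‖h‖ - ‖a • A h‖ ≤ ‖h - a • A h‖ := norm_sub_norm_le _ _
  have h2 : ‖a • A h‖ ≤ ‖a‖ * ‖h‖ := by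
    rw [norm_smul]; exact mul_le_mul_of_nonneg_left (hA h) (norm_nonneg _)
  linarith

/-- The value at `A` of the Blaschke factor `(z - a) / (1 - conj a * z)` has norm at most `3`:
its Taylor coefficients have absolute sum `1 + 2 ‖a‖`. -/
theorem norm_blaschke_le {A : E →ₗ[ℂ] E} (hA : ∀ v, ‖A v‖ ≤ ‖v‖) {a : ℂ} (ha : ‖a‖ < 1) (h : E) :
    ‖A h - a • h‖ ≤ 3 * ‖h - (starRingEnd ℂ a) • A h‖ := by
  set w := h - (starRingEnd ℂ a) • A h with hw
  have hh : (1 - ‖a‖) * ‖h‖ ≤ ‖w‖ := by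
    simpa using one_sub_norm_mul_norm_le hA (starRingEnd ℂ a) h
  have key : A h - a • h = -(a • w) + ((1 - ‖a‖ ^ 2 : ℝ) : ℂ) • A h := by
    have : ((1 - ‖a‖ ^ 2 : ℝ) : ℂ) = 1 - a * starRingEnd ℂ a := by
      rw [Complex.mul_conj, Complex.normSq_eq_norm_sq]; push_cast; ring
    rw [this, hw]; module
  have hpos : 0 ≤ 1 - ‖a‖ ^ 2 := by nlinarith [norm_nonneg a]
  calc ‖A h - a • h‖ ≤ ‖a‖ * ‖w‖ + (1 - ‖a‖ ^ 2) * ‖h‖ := by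
        rw [key]
        refine (norm_add_le _ _).trans ?_
        rw [norm_neg, norm_smul, norm_smul, Complex.norm_real, Real.norm_of_nonneg hpos]
        gcongr
        exact hA h
    _ ≤ ‖a‖ * ‖w‖ + (1 + ‖a‖) * ‖w‖ := by
        have := mul_le_mul_of_nonneg_left hh (by positivity : 0 ≤ 1 + ‖a‖)
        nlinarith
    _ ≤ 3 * ‖w‖ := by nlinarith [norm_nonneg w]

theorem norm_one_sub_conj_mul_le {a z : ℂ} (ha : ‖a‖ ≤ 1) (hz : 1 ≤ ‖z‖) :
    ‖1 - (starRingEnd ℂ a) * z‖ ≤ ‖z - a‖ := by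
  have h : ‖z - a‖ ^ 2 - ‖1 - (starRingEnd ℂ a) * z‖ ^ 2 = (‖z‖ ^ 2 - 1) * (1 - ‖a‖ ^ 2) := by
    simp only [← Complex.normSq_eq_norm_sq, Complex.normSq_apply, Complex.sub_re, Complex.sub_im,
      Complex.mul_re, Complex.mul_im, Complex.conj_re, Complex.conj_im, Complex.one_re,
      Complex.one_im]
    ring
  have h1 : 0 ≤ (‖z‖ ^ 2 - 1) * (1 - ‖a‖ ^ 2) := by
    apply mul_nonneg <;> nlinarith [norm_nonneg a]
  exact le_of_sq_le_sq (by linarith) (norm_nonneg _)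

/-- Resolvent bound for a contraction `A`: outside the unit disc, on the vectors annihilated by
`∏ (A - a)` with all `a` in the disc of radius `r`, the inverse of `z - A` is bounded by
`(3 ^ k - 1) / (‖z‖ - r)`, where `k` is the number of factors. The power of the distance is one,
however large `k` is; this is where the contraction property enters. One factor is removed at a
time by means of the corresponding Blaschke factor. -/
theorem resolvent_bound [FiniteDimensional ℂ E] {A : E →ₗ[ℂ] E} (hA : ∀ v, ‖A v‖ ≤ ‖v‖)
    {r : ℝ} (hr : r < 1) {z : ℂ} (hz : 1 ≤ ‖z‖) (s : Multiset ℂ) (hs : ∀ a ∈ s, ‖a‖ ≤ r) (v : E)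
    (hv : Polynomial.aeval A (s.map fun a => Polynomial.X - Polynomial.C a).prod v = 0) :
    (‖z‖ - r) * ‖v‖ ≤ (3 ^ s.card - 1) * ‖z • v - A v‖ := by
  induction s using Multiset.induction_on generalizing v with
  | empty =>
    have : v = 0 := by simpa using hv
    simp [this]
  | cons a s ih =>
    have har : ‖a‖ ≤ r := hs a (Multiset.mem_cons_self a s)
    have ha : ‖a‖ < 1 := har.trans_lt hr
    set T : E →ₗ[ℂ] E := LinearMap.id - (starRingEnd ℂ a) • A with hT
    have hTapp : ∀ h, T h = h - (starRingEnd ℂ a) • A h := fun h => by simp [hT]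
    have hinj : Function.Injective T := by
      rw [injective_iff_map_eq_zero]
      intro h hh
      have h1 := one_sub_norm_mul_norm_le hA (starRingEnd ℂ a) h
      rw [← hTapp, hh, norm_zero, RCLike.norm_conj] at h1
      have h2 : ‖h‖ ≤ 0 := by
        by_contra hc
        nlinarith [mul_pos (sub_pos.2 ha) (not_le.1 hc)]
      exact norm_le_zero_iff.1 h2
    obtain ⟨u, hu⟩ := LinearMap.injective_iff_surjective.1 hinj v
    set p := (s.map fun a => Polynomial.X - Polynomial.C a).prod with hp
    have hcomm : Commute (Polynomial.aeval A p) T := by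
      have : T = Polynomial.aeval A (1 - Polynomial.C (starRingEnd ℂ a) * Polynomial.X) := by
        ext h; simp [hT]
      rw [this]
      exact (Commute.all _ _).map (Polynomial.aeval A)
    set v' := A u - a • u with hv'
    have hv'0 : Polynomial.aeval A p v' = 0 := by
      apply hinj
      rw [map_zero]
      have e1 : T (Polynomial.aeval A p v') = Polynomial.aeval A p (T v') :=
        (LinearMap.congr_fun hcomm.eq v').symm
      have e2 : T v' = A v - a • v := by
        rw [← hu, hv', hTapp, hTapp]; simp only [map_sub, map_smul]; module
      rw [e1, e2, ← hv, Multiset.map_cons, Multiset.prod_cons, ← hp, mul_comm, map_mul]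
      simp
    set h := z • u - A u with hh
    have hw : z • v - A v = h - (starRingEnd ℂ a) • A h := by
      rw [← hu, hh, hTapp]; simp only [map_sub, map_smul]; module
    have hw' : z • v' - A v' = A h - a • h := by
      rw [hh, hv']; simp only [map_sub, map_smul]; module
    have h3 := norm_blaschke_le hA ha h
    rw [← hw', ← hw] at h3
    have h4 := ih (fun b hb => hs b (Multiset.mem_cons_of_mem hb)) v' hv'0
    have hhw : (1 - ‖a‖) * ‖h‖ ≤ ‖z • v - A v‖ := by
      rw [hw]; simpa using one_sub_norm_mul_norm_le hA (starRingEnd ℂ a) h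
    have key : (z - a) • v = (1 - (starRingEnd ℂ a) * z) • v' + ((1 - ‖a‖ ^ 2 : ℝ) : ℂ) • h := by
      have : ((1 - ‖a‖ ^ 2 : ℝ) : ℂ) = 1 - a * starRingEnd ℂ a := by
        rw [Complex.mul_conj, Complex.normSq_eq_norm_sq]; push_cast; ring
      rw [this, hh, hv', ← hu, hTapp]; module
    have hpos : 0 ≤ 1 - ‖a‖ ^ 2 := by nlinarith [norm_nonneg a]
    set W := ‖z • v - A v‖ with hW
    have hW0 : 0 ≤ W := norm_nonneg _
    have h5 : ‖z - a‖ * ‖v‖ ≤ ‖z - a‖ * ‖v'‖ + 2 * W := by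
      have e := congrArg norm key
      rw [norm_smul] at e
      rw [e]
      refine (norm_add_le _ _).trans ?_
      rw [norm_smul, norm_smul, Complex.norm_real, Real.norm_of_nonneg hpos]
      have := norm_one_sub_conj_mul_le ha.le hz
      refine add_le_add (mul_le_mul_of_nonneg_right this (norm_nonneg _)) ?_
      nlinarith [mul_le_mul_of_nonneg_left hhw (by positivity : 0 ≤ 1 + ‖a‖)]
    have hd : ‖z‖ - r ≤ ‖z - a‖ := by linarith [norm_sub_norm_le z a]
    have h6 : (‖z‖ - r) * (‖v‖ - ‖v'‖) ≤ 2 * W := by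
      rcases le_total ‖v‖ ‖v'‖ with hc | hc
      · nlinarith
      · nlinarith [mul_le_mul_of_nonneg_right hd (sub_nonneg.2 hc)]
    have h7 : (3 ^ s.card - 1 : ℝ) * ‖z • v' - A v'‖ ≤ (3 ^ s.card - 1) * (3 * W) :=
      mul_le_mul_of_nonneg_left h3 (sub_nonneg.2 (one_le_pow₀ (by norm_num)))
    rw [Multiset.card_cons, pow_succ]
    nlinarith

end Resolvent

/-! ### Fixed vectors of irreducible nonnegative matrices -/

section Perron

open Matrix

variable {ι : Type*}

/-- Every index is reached from every index along nonzero entries of `A`. -/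
def Irred (A : Matrix ι ι ℝ) : Prop :=
  ∀ i j, Relation.ReflTransGen (fun i j => 0 < A i j) i j

theorem Irred.transpose {A : Matrix ι ι ℝ} (h : Irred A) : Irred Aᵀ := fun i j => by
  have := (h j i).swap
  exact this

variable [Fintype ι]

/-- The triangle inequality gives `|x| ≤ A |x|`; both sides have the same sum against the positive
left fixed vector, so they agree. -/
theorem mulVec_abs_eq {A : Matrix ι ι ℝ} (hA : ∀ i j, 0 ≤ A i j) {l : ι → ℝ} (hl : ∀ i, 0 < l i)
    (hlA : l ᵥ* A = l) {x : ι → ℝ} (hx : A *ᵥ x = x) : A *ᵥ |x| = |x| := by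
  have hle : ∀ i, |x| i ≤ (A *ᵥ |x|) i := fun i => by
    calc |x| i = |(A *ᵥ x) i| := by rw [hx]; rfl
      _ ≤ ∑ j, |A i j * x j| := Finset.abs_sum_le_sum_abs _ _
      _ = (A *ᵥ |x|) i := by
        simp only [mulVec, dotProduct, abs_mul, abs_of_nonneg (hA _ _), Pi.abs_apply]
  have hsum : ∑ i, l i * |x| i = ∑ i, l i * (A *ᵥ |x|) i := by
    change l ⬝ᵥ |x| = l ⬝ᵥ (A *ᵥ |x|)
    rw [dotProduct_mulVec, hlA]
  have := (Finset.sum_eq_sum_iff_of_le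
    (fun i _ => mul_le_mul_of_nonneg_left (hle i) (hl i).le)).1 hsum
  ext i
  exact (mul_left_cancel₀ (hl i).ne' (this i (Finset.mem_univ i))).symm

theorem pos_of_mulVec_eq {A : Matrix ι ι ℝ} (hA : ∀ i j, 0 ≤ A i j) (hirr : Irred A) {x : ι → ℝ}
    (hx0 : ∀ i, 0 ≤ x i) (hx : A *ᵥ x = x) {j : ι} (hj : 0 < x j) (i : ι) : 0 < x i := by
  have := hirr i j
  induction this using Relation.ReflTransGen.head_induction_on with
  | refl => exact hj
  | head h _ ih =>
    rename_i a c _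
    rw [← hx]
    exact (mul_pos h ih).trans_le
      (Finset.single_le_sum (f := fun k => A a k * x k) (fun k _ => mul_nonneg (hA a k) (hx0 k))
        (Finset.mem_univ c))

theorem eq_zero_of_mulVec_eq {A : Matrix ι ι ℝ} (hA : ∀ i j, 0 ≤ A i j) (hirr : Irred A)
    {l : ι → ℝ} (hl : ∀ i, 0 < l i) (hlA : l ᵥ* A = l) {x : ι → ℝ} (hx : A *ᵥ x = x)
    (hlx : l ⬝ᵥ x = 0) : x = 0 := by
  have habs := mulVec_abs_eq hA hl hlA hx
  -- A sign change is excluded: the positive part `|x| + x` is fixed, so it vanishes everywhere or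
  -- nowhere.
  have hpos : A *ᵥ (|x| + x) = |x| + x := by rw [mulVec_add, habs, hx]
  have hnn : ∀ i, 0 ≤ (|x| + x) i := fun i => by
    simp only [Pi.add_apply, Pi.abs_apply]; linarith [neg_abs_le (x i)]
  have hsign : (∀ i, x i ≤ 0) ∨ ∀ i, 0 ≤ x i := by
    by_cases h : ∃ j, 0 < (|x| + x) j
    · obtain ⟨j, hj⟩ := h
      right
      intro i
      have := pos_of_mulVec_eq hA hirr hnn hpos hj i
      simp only [Pi.add_apply, Pi.abs_apply] at this
      by_contra hc
      rw [abs_of_neg (not_le.1 hc)] at this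
      linarith
    · left
      intro i
      have h' := not_lt.1 (not_exists.1 h i)
      simp only [Pi.add_apply, Pi.abs_apply] at h'
      linarith [abs_nonneg (x i)]
  have hzero : ∀ i, l i * x i = 0 := by
    rcases hsign with h | h
    · exact fun i => (Finset.sum_eq_zero_iff_of_nonpos
        (fun i _ => mul_nonpos_of_nonneg_of_nonpos (hl i).le (h i))).1 hlx i (Finset.mem_univ i)
    · exact fun i => (Finset.sum_eq_zero_iff_of_nonneg
        (fun i _ => mul_nonneg (hl i).le (h i))).1 hlx i (Finset.mem_univ i)
  ext i
  exact (mul_eq_zero.1 (hzero i)).resolve_left (hl i).ne'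

theorem exists_pos_fixed [DecidableEq ι] [Nonempty ι] {A : Matrix ι ι ℝ} (hA : ∀ i j, 0 ≤ A i j)
    (hirr : Irred A) {l : ι → ℝ} (hl : ∀ i, 0 < l i) (hlA : l ᵥ* A = l) :
    ∃ x : ι → ℝ, (∀ i, 0 < x i) ∧ ∑ i, x i = 1 ∧ A *ᵥ x = x := by
  have hdet : (A - 1).det = 0 := by
    refine exists_vecMul_eq_zero_iff.1 ⟨l, ?_, by rw [vecMul_sub, hlA, vecMul_one, sub_self]⟩
    intro h
    exact (hl (Classical.arbitrary ι)).ne' (congrFun h _)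
  obtain ⟨x, hx0, hx⟩ := exists_mulVec_eq_zero_iff.2 hdet
  rw [sub_mulVec, one_mulVec, sub_eq_zero] at hx
  have habs := mulVec_abs_eq hA hl hlA hx
  obtain ⟨j, hj⟩ := Function.ne_iff.1 hx0
  have hpos := pos_of_mulVec_eq hA hirr (fun i => abs_nonneg (x i)) habs (abs_pos.2 hj)
  have hS : 0 < ∑ i, |x| i := Finset.sum_pos (fun i _ => hpos i) Finset.univ_nonempty
  refine ⟨(∑ i, |x| i)⁻¹ • |x|, fun i => mul_pos (inv_pos.2 hS) (hpos i), ?_, ?_⟩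
  · simp only [Pi.smul_apply, smul_eq_mul, ← Finset.mul_sum]
    exact inv_mul_cancel₀ hS.ne'
  · rw [mulVec_smul, habs]

/-- The complex form of `eq_zero_of_mulVec_eq`. -/
theorem eq_zero_of_map_mulVec_eq {A : Matrix ι ι ℝ} (hA : ∀ i j, 0 ≤ A i j) (hirr : Irred A)
    {l : ι → ℝ} (hl : ∀ i, 0 < l i) (hlA : l ᵥ* A = l) {x : ι → ℂ}
    (hx : A.map (algebraMap ℝ ℂ) *ᵥ x = x) (hlx : ∑ i, (l i : ℂ) * x i = 0) : x = 0 := by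
  have hre : (fun i => (x i).re) = 0 := by
    refine eq_zero_of_mulVec_eq hA hirr hl hlA ?_ ?_
    · ext i
      have := congrArg Complex.re (congrFun hx i)
      simpa [mulVec, dotProduct] using this
    · simpa [dotProduct] using congrArg Complex.re hlx
  have him : (fun i => (x i).im) = 0 := by
    refine eq_zero_of_mulVec_eq hA hirr hl hlA ?_ ?_
    · ext i
      have := congrArg Complex.im (congrFun hx i)
      simpa [mulVec, dotProduct] using this
    · simpa [dotProduct] using congrArg Complex.im hlx
  ext i
  exact Complex.ext (congrFun hre i) (congrFun him i)

end Perron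

/-! ### Eigenvalues of the weight matrices -/

section Spectrum

open Matrix

variable {n : ℕ}

theorem norm_mulVec_le_of_rowSumsOne {W : Matrix (Fin n) (Fin n) ℝ} (h0 : ∀ i j, 0 ≤ W i j)
    (h1 : RowSumsOne W) (v : Fin n → ℂ) : ‖W.map (algebraMap ℝ ℂ) *ᵥ v‖ ≤ ‖v‖ := by
  refine (pi_norm_le_iff_of_nonneg (norm_nonneg v)).2 fun i => ?_
  calc ‖(W.map (algebraMap ℝ ℂ) *ᵥ v) i‖ ≤ ∑ j, ‖W.map (algebraMap ℝ ℂ) i j * v j‖ := by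
        simp only [mulVec, dotProduct]; exact norm_sum_le _ _
    _ = ∑ j, W i j * ‖v j‖ := by
        simp [abs_of_nonneg (h0 _ _)]
    _ ≤ ∑ j, W i j * ‖v‖ :=
        Finset.sum_le_sum fun j _ => mul_le_mul_of_nonneg_left (norm_le_pi_norm v j) (h0 i j)
    _ = ‖v‖ := by rw [← Finset.sum_mul, h1 i, one_mul]

theorem sum_norm_mulVec_le_of_colSumsOne {W : Matrix (Fin n) (Fin n) ℝ} (h0 : ∀ i j, 0 ≤ W i j)
    (h1 : ColSumsOne W) (v : Fin n → ℂ) :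
    ∑ i, ‖(W.map (algebraMap ℝ ℂ) *ᵥ v) i‖ ≤ ∑ i, ‖v i‖ := by
  calc ∑ i, ‖(W.map (algebraMap ℝ ℂ) *ᵥ v) i‖
      ≤ ∑ i, ∑ j, ‖W.map (algebraMap ℝ ℂ) i j * v j‖ :=
        Finset.sum_le_sum fun i _ => by
          simp only [mulVec, dotProduct]; exact norm_sum_le _ _
    _ = ∑ j, ∑ i, W i j * ‖v j‖ := by
        rw [Finset.sum_comm]; simp [abs_of_nonneg (h0 _ _)]
    _ = ∑ j, ‖v j‖ := by simp_rw [← Finset.sum_mul, h1 _, one_mul]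

theorem exists_roots_eq_cons {W : Matrix (Fin n) (Fin n) ℝ} (hn : n ≠ 0) (h0 : ∀ i j, 0 ≤ W i j)
    (h1 : RowSumsOne W) :
    ∃ s : Multiset ℂ, (W.map (algebraMap ℝ ℂ)).charpoly.roots = 1 ::ₘ s ∧ s.card = n - 1 ∧
      ∀ a ∈ s, ‖a‖ ≤ 1 := by
  have : NeZero n := ⟨hn⟩
  set M := W.map (algebraMap ℝ ℂ) with hM
  have hmem : (1 : ℂ) ∈ M.charpoly.roots := by
    rw [Polynomial.mem_roots M.charpoly_monic.ne_zero, Polynomial.IsRoot, eval_charpoly]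
    refine exists_mulVec_eq_zero_iff.1 ⟨fun _ => 1, fun h => one_ne_zero (congrFun h 0), ?_⟩
    rw [sub_mulVec, map_one, one_mulVec, sub_eq_zero]
    ext i
    have := congrArg (algebraMap ℝ ℂ) (h1 i)
    simpa [hM, mulVec, dotProduct] using this.symm
  obtain ⟨s, hs⟩ := Multiset.exists_cons_of_mem hmem
  refine ⟨s, hs, ?_, fun a ha => ?_⟩
  · have hc : M.charpoly.roots.card = n := by
      rw [← (IsAlgClosed.splits M.charpoly).natDegree_eq_card_roots, charpoly_natDegree_eq_dim,
        Fintype.card_fin]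
    rw [hs, Multiset.card_cons] at hc
    omega
  · have ha' : a ∈ M.charpoly.roots := by rw [hs]; exact Multiset.mem_cons_of_mem ha
    rw [Polynomial.mem_roots M.charpoly_monic.ne_zero, Polynomial.IsRoot, eval_charpoly] at ha'
    obtain ⟨v, hv0, hv⟩ := exists_mulVec_eq_zero_iff.2 ha'
    have hv' : M *ᵥ v = a • v := by
      rw [sub_mulVec, sub_eq_zero] at hv
      rw [← hv]; ext i; simp [scalar_apply, mulVec_diagonal]
    have := norm_mulVec_le_of_rowSumsOne h0 h1 v
    rw [← hM, hv', norm_smul] at this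
    exact le_of_mul_le_mul_right (by simpa using this) (norm_pos_iff.2 hv0)

/-- The eigenvalues of `W_r` and `W_c` other than the common eigenvalue `1` are bounded by
`|λ₃|`. -/
theorem exists_roots_le_thirdModulus {Wr Wc : Matrix (Fin n) (Fin n) ℝ} (hn : n ≠ 0)
    (hr0 : ∀ i j, 0 ≤ Wr i j) (hr1 : RowSumsOne Wr)
    (hc0 : ∀ i j, 0 ≤ Wc i j) (hc1 : ColSumsOne Wc) :
    0 ≤ thirdModulus (augmented Wr Wc 0) ∧ thirdModulus (augmented Wr Wc 0) ≤ 1 ∧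
    (∃ s : Multiset ℂ, (Wr.map (algebraMap ℝ ℂ)).charpoly.roots = 1 ::ₘ s ∧ s.card = n - 1 ∧
      ∀ a ∈ s, ‖a‖ ≤ thirdModulus (augmented Wr Wc 0)) ∧
    (∃ s : Multiset ℂ, (Wc.map (algebraMap ℝ ℂ)).charpoly.roots = 1 ::ₘ s ∧ s.card = n - 1 ∧
      ∀ a ∈ s, ‖a‖ ≤ thirdModulus (augmented Wr Wc 0)) := by
  obtain ⟨s, hs, hsc, hs1⟩ := exists_roots_eq_cons hn hr0 hr1
  obtain ⟨t, ht, htc, ht1⟩ := exists_roots_eq_cons (W := Wcᵀ) hn (fun i j => hc0 j i) hc1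
  rw [transpose_map, charpoly_transpose] at ht
  set c : Multiset ℝ := (s + t).map fun z : ℂ => ‖z‖ with hc
  have hc_le : ∀ b ∈ c, b ≤ 1 := by
    intro b hb
    obtain ⟨a, ha, rfl⟩ := Multiset.mem_map.1 hb
    rcases Multiset.mem_add.1 ha with h | h
    · exact hs1 a h
    · exact ht1 a h
  have hmod : eigenvalueModuli (augmented Wr Wc 0) = 1 :: 1 :: c.sort (· ≥ ·) := by
    have hroots : ((augmented Wr Wc 0).map (algebraMap ℝ ℂ)).charpoly.roots =
        1 ::ₘ 1 ::ₘ (s + t) := by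
      have : (augmented Wr Wc 0).map (algebraMap ℝ ℂ) = fromBlocks (Wr.map (algebraMap ℝ ℂ)) 0
          ((1 - Wr).map (algebraMap ℝ ℂ)) (Wc.map (algebraMap ℝ ℂ)) := by
        rw [augmented, fromBlocks_map]; simp
      rw [this, charpoly_fromBlocks_zero₁₂, Polynomial.roots_mul
        (mul_ne_zero (charpoly_monic _).ne_zero (charpoly_monic _).ne_zero), hs, ht]
      simp
    rw [eigenvalueModuli, hroots, Multiset.map_cons, Multiset.map_cons, norm_one,
      Multiset.sort_cons, Multiset.sort_cons]
    · exact hc_le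
    · intro b hb
      rcases Multiset.mem_cons.1 hb with rfl | hb
      · exact le_rfl
      · exact hc_le b hb
  have hthird : thirdModulus (augmented Wr Wc 0) = (c.sort (· ≥ ·)).getD 0 0 := by
    rw [thirdModulus, hmod]; rfl
  have hle : ∀ b ∈ c, b ≤ thirdModulus (augmented Wr Wc 0) := by
    intro b hb
    rw [hthird]
    have hb' : b ∈ c.sort (· ≥ ·) := (Multiset.mem_sort _).2 hb
    have hsorted := Multiset.pairwise_sort c (· ≥ ·)
    cases hl : c.sort (· ≥ ·) with
    | nil => rw [hl] at hb'; simp at hb'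
    | cons a l =>
      rw [hl] at hb' hsorted
      rcases List.mem_cons.1 hb' with rfl | h
      · exact le_rfl
      · exact (List.pairwise_cons.1 hsorted).1 b h
  have hmem : thirdModulus (augmented Wr Wc 0) = 0 ∨ thirdModulus (augmented Wr Wc 0) ∈ c := by
    rw [hthird]
    cases hl : c.sort (· ≥ ·) with
    | nil => left; rfl
    | cons a l =>
      right
      rw [← Multiset.mem_sort (r := (· ≥ ·)), hl]
      exact List.mem_cons_self
  refine ⟨?_, ?_, ⟨s, hs, hsc, fun a ha => hle _ ?_⟩, ⟨t, ht, htc, fun a ha => hle _ ?_⟩⟩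
  · rcases hmem with h | h
    · exact h.ge
    · obtain ⟨a, -, ha⟩ := Multiset.mem_map.1 h
      exact ha ▸ norm_nonneg a
  · rcases hmem with h | h
    · rw [h]; exact zero_le_one
    · exact hc_le _ h
  · exact Multiset.mem_map_of_mem _ (Multiset.mem_add.2 (Or.inl ha))
  · exact Multiset.mem_map_of_mem _ (Multiset.mem_add.2 (Or.inr ha))

/-- The resolvent of an irreducible nonnegative matrix on the hyperplane complementary to its
Perron vector, in any norm for which the matrix is a contraction. -/
theorem resolvent_bound_of_irred {A : Matrix (Fin n) (Fin n) ℝ} (hA : ∀ i j, 0 ≤ A i j)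
    (hirr : Irred A) {l : Fin n → ℝ} (hl : ∀ i, 0 < l i) (hlA : l ᵥ* A = l)
    {E : Type*} [NormedAddCommGroup E] [NormedSpace ℂ E] (e : (Fin n → ℂ) ≃ₗ[ℂ] E)
    (hcontr : ∀ v, ‖e (A.map (algebraMap ℝ ℂ) *ᵥ v)‖ ≤ ‖e v‖)
    {s : Multiset ℂ} (hs : (A.map (algebraMap ℝ ℂ)).charpoly.roots = 1 ::ₘ s)
    {r : ℝ} (hr : r < 1) (hsr : ∀ a ∈ s, ‖a‖ ≤ r) {z : ℂ} (hz : 1 ≤ ‖z‖) (v : Fin n → ℂ)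
    (hv : ∑ i, (l i : ℂ) * v i = 0) :
    (‖z‖ - r) * ‖e v‖ ≤ 3 ^ s.card * ‖e (z • v - A.map (algebraMap ℝ ℂ) *ᵥ v)‖ := by
  set M := A.map (algebraMap ℝ ℂ) with hM
  have : FiniteDimensional ℂ E := e.finiteDimensional
  set p := (s.map fun a => Polynomial.X - Polynomial.C a).prod with hp
  have hchar : M.charpoly = p * (Polynomial.X - Polynomial.C 1) := by
    have := Polynomial.prod_multiset_X_sub_C_of_monic_of_roots_card_eq M.charpoly_monic
      (IsAlgClosed.splits M.charpoly).natDegree_eq_card_roots.symm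
    rw [← this, hs, Multiset.map_cons, Multiset.prod_cons, mul_comm]
  -- `p(M) v` is a fixed vector in the hyperplane, hence zero.
  have hfun : ∀ u : Fin n → ℂ, ∑ i, (l i : ℂ) * (M *ᵥ u) i = ∑ i, (l i : ℂ) * u i := by
    intro u
    have h1 : (fun i => (l i : ℂ)) ᵥ* M = fun i => (l i : ℂ) := by
      ext j
      have := congrArg (algebraMap ℝ ℂ) (congrFun hlA j)
      simpa [vecMul, dotProduct, hM] using this
    change (fun i => (l i : ℂ)) ⬝ᵥ (M *ᵥ u) = (fun i => (l i : ℂ)) ⬝ᵥ u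
    rw [dotProduct_mulVec, h1]
  have hker : ∀ q : Polynomial ℂ, ∑ i, (l i : ℂ) * (Polynomial.aeval M q *ᵥ v) i = 0 := by
    intro q
    induction q using Polynomial.induction_on with
    | C a =>
      have : Polynomial.aeval M (Polynomial.C a) *ᵥ v = a • v := by
        rw [Polynomial.aeval_C, Algebra.algebraMap_eq_smul_one, smul_mulVec, one_mulVec]
      rw [this]
      simp only [Pi.smul_apply, smul_eq_mul, mul_left_comm _ a, ← Finset.mul_sum, hv, mul_zero]
    | add p q hp hq =>
      rw [map_add, add_mulVec]
      simp only [Pi.add_apply, mul_add, Finset.sum_add_distrib, hp, hq, add_zero]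
    | monomial k a h =>
      have : Polynomial.aeval M (Polynomial.C a * Polynomial.X ^ (k + 1)) *ᵥ v =
          M *ᵥ (Polynomial.aeval M (Polynomial.C a * Polynomial.X ^ k) *ᵥ v) := by
        rw [mulVec_mulVec, pow_succ', ← mul_assoc, mul_comm (Polynomial.C a), mul_assoc, map_mul,
          Polynomial.aeval_X]
      rw [this, hfun, h]
  have hzero : Polynomial.aeval M p *ᵥ v = 0 := by
    refine eq_zero_of_map_mulVec_eq hA hirr hl hlA ?_ (hker p)
    have h := M.aeval_self_charpoly
    rw [hchar, mul_comm, map_mul] at h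
    have h2 := congrArg (· *ᵥ v) h
    simp only [map_sub, Polynomial.aeval_X, map_one, zero_mulVec] at h2
    rw [← mulVec_mulVec, sub_mulVec, one_mulVec, sub_eq_zero] at h2
    exact h2
  set L : E →ₗ[ℂ] E := LinearEquiv.conjAlgEquiv ℂ e (Matrix.toLinAlgEquiv' M) with hL
  have hLe : ∀ u, L (e u) = e (M *ᵥ u) := fun u => by
    simp [hL, Matrix.toLinAlgEquiv'_apply]
  have hpL : Polynomial.aeval L p (e v) = 0 := by
    have h1 : Polynomial.aeval L p =
        LinearEquiv.conjAlgEquiv ℂ e (Matrix.toLinAlgEquiv' (Polynomial.aeval M p)) := by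
      rw [hL, Polynomial.aeval_algHom_apply, Polynomial.aeval_algHom_apply]
    rw [h1]
    simp [Matrix.toLinAlgEquiv'_apply, hzero]
  have hmain := resolvent_bound (A := L) (fun w => by
    obtain ⟨u, rfl⟩ := e.surjective w
    rw [hLe]; exact hcontr u) hr hz s hsr (e v) hpL
  rw [hLe, ← map_smul, ← map_sub] at hmain
  refine hmain.trans (mul_le_mul_of_nonneg_right ?_ (norm_nonneg _))
  linarith

end Spectrum

/-! ### Eigenvalues of the perturbed matrix -/

section Perturbation

open Matrix

variable {n : ℕ}

/-- The real inequality that excludes an eigenvalue `z ≠ 1` outside the open unit disc: to first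
order such an eigenvalue would be `1 - q` with `q > 0`. -/
theorem false_of_norm_sub_one_add_le {z : ℂ} (hz : 1 ≤ ‖z‖) {q : ℝ} (hq : 0 < q) (hq1 : q ≤ 1 / 20)
    (h : ‖z - 1 + q‖ ≤ q / 4 + ‖z - 1‖ / 4) : False := by
  have h1 : ‖z - 1 + q‖ ^ 2 = ‖z - 1‖ ^ 2 + 2 * q * (z.re - 1) + q ^ 2 := by
    simp only [← Complex.normSq_eq_norm_sq, Complex.normSq_apply, Complex.sub_re, Complex.sub_im,
      Complex.add_re, Complex.add_im, Complex.ofReal_re, Complex.ofReal_im, Complex.one_re,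
      Complex.one_im]
    ring
  have h2 : ‖z‖ ^ 2 = 1 + 2 * (z.re - 1) + ‖z - 1‖ ^ 2 := by
    simp only [← Complex.normSq_eq_norm_sq, Complex.normSq_apply, Complex.sub_re, Complex.sub_im,
      Complex.one_re, Complex.one_im]
    ring
  have h3 : ‖z - 1 + q‖ ^ 2 ≤ (q / 4 + ‖z - 1‖ / 4) ^ 2 :=
    pow_le_pow_left₀ (norm_nonneg _) h 2
  have h4 : -‖z - 1‖ ^ 2 ≤ 2 * (z.re - 1) := by nlinarith
  have h5 := mul_le_mul_of_nonneg_left h4 hq.le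
  have h6 := mul_le_mul_of_nonneg_right hq1 (sq_nonneg ‖z - 1‖)
  nlinarith [sq_nonneg (q - ‖z - 1‖), sq_nonneg ‖z - 1‖, pow_pos hq 2]

/-- The scalar estimates for an eigenvector of the perturbed matrix. Here `S` is the size of the
component of `y` along the Perron vector and `V` that of the rest, `X` is the size of `w` off the
constants, `B` that of the average of `y` against the left Perron vector, `k` the resolvent
constant and `N` the distance of the eigenvalue from `1`. The factor `N` in the bound of `X` and
the factor `p` in that of `B` are what allows a comparison with `ε * m * p`, which may be
arbitrarily small. -/
theorem perturbation_estimate {m ε k p S V X B Y N T : ℝ} (hm : 1 ≤ m) (hε : 0 ≤ ε) (hk : 1 ≤ k)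
    (hsmall : 20 * m * k ^ 2 * ε ≤ 1) (hp : 0 ≤ p) (hS : 0 ≤ S) (hV : 0 ≤ V)
    (hY0 : 0 ≤ Y) (hN : 0 ≤ N) (hX1 : X ≤ 2 * k * ε * N * Y) (hX2 : X ≤ 4 * k * ε * Y)
    (hVX : V ≤ 2 * m * k * (ε * B + X)) (hB1 : B ≤ Y) (hB2 : B ≤ S * p + V) (hY : Y ≤ S + V)
    (hT : T * S ≤ ε * m * V + m * X) :
    Y ≤ 2 * S ∧ T * S ≤ (ε * m * p / 4 + N / 4) * S := by
  set σ := 2 * m * k * ε with hσ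
  have hk0 : 0 ≤ k := by linarith
  have hm0 : 0 ≤ m := by linarith
  have hσ0 : 0 ≤ σ := by positivity
  have hσk : σ * k ≤ 1 / 10 := by rw [hσ]; nlinarith
  have hσ1 : σ ≤ 1 / 10 := by nlinarith
  have hem : ε * m ≤ σ / 2 := by
    rw [hσ]; nlinarith [mul_nonneg hε hm0]
  have hem0 : 0 ≤ ε * m := mul_nonneg hε hm0
  have hmk : 0 ≤ 2 * m * k := by positivity
  -- The crude bound: the component of `y` along the Perron vector dominates.
  have hV1 : V ≤ Y / 2 := by
    have e1 : V ≤ 2 * m * k * (ε * Y + 4 * k * ε * Y) := by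
      refine hVX.trans (mul_le_mul_of_nonneg_left ?_ hmk)
      nlinarith [mul_le_mul_of_nonneg_left hB1 hε]
    have e2 : 2 * m * k * (ε * Y + 4 * k * ε * Y) = σ * Y + 4 * (σ * k) * Y := by rw [hσ]; ring
    nlinarith [mul_le_mul_of_nonneg_right hσk hY0, mul_le_mul_of_nonneg_right hσ1 hY0]
  have hYS : Y ≤ 2 * S := by linarith
  refine ⟨hYS, ?_⟩
  have hNS : 0 ≤ N * S := mul_nonneg hN hS
  have hpS : 0 ≤ S * p := mul_nonneg hS hp
  have hNY : N * Y ≤ 2 * (N * S) := by nlinarith [mul_le_mul_of_nonneg_left hYS hN]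
  -- The finer bound for the remaining component.
  have hV2 : V ≤ 10 / 9 * (σ * (S * p) + 2 / 5 * (N * S)) := by
    have e1 : V ≤ 2 * m * k * (ε * (S * p + V) + 2 * k * ε * N * Y) := by
      refine hVX.trans (mul_le_mul_of_nonneg_left ?_ hmk)
      nlinarith [mul_le_mul_of_nonneg_left hB2 hε]
    have e2 : 2 * m * k * (ε * (S * p + V) + 2 * k * ε * N * Y) =
        σ * (S * p) + σ * V + 2 * (σ * k) * (N * Y) := by rw [hσ]; ring
    have e3 := mul_le_mul_of_nonneg_right hσ1 hV
    have e4 := mul_le_mul_of_nonneg_right hσk (mul_nonneg hN hY0)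
    nlinarith
  have hmX : m * X ≤ 1 / 5 * (N * S) := by
    have e1 : m * X ≤ σ * (N * Y) := by
      rw [hσ]; nlinarith [mul_le_mul_of_nonneg_left hX1 hm0]
    nlinarith [mul_le_mul_of_nonneg_right hσ1 (mul_nonneg hN hY0)]
  have hemV : ε * m * V ≤ 1 / 9 * (ε * m * (S * p)) + 1 / 40 * (N * S) := by
    have e1 := mul_le_mul_of_nonneg_left hV2 hem0
    have e2 := mul_le_mul_of_nonneg_left hσ1 (mul_nonneg hem0 hpS)
    have e3 : ε * m * (N * S) ≤ 1 / 20 * (N * S) :=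
      mul_le_mul_of_nonneg_right (by linarith) hNS
    nlinarith
  nlinarith [mul_nonneg hem0 hpS]

/-- The pencil `(z - R)(z - C) + ε (z - 1)` is injective for `z ≠ 1` outside the open unit disc.
Here `R` fixes the constants and `a` is its left Perron vector, and `C` preserves sums and `b` is
its right Perron vector; `w` stands for `(z - C) y`. -/
theorem eq_zero_of_pencil {R C : Matrix (Fin n) (Fin n) ℂ} {a b : Fin n → ℝ} {r K ε : ℝ} {z : ℂ}
    (hn : n ≠ 0) (ha0 : ∀ i, 0 < a i) (ha1 : ∑ i, a i = 1) (hb0 : ∀ i, 0 < b i)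
    (hb1 : ∑ i, b i = 1)
    (haR : ∀ v : Fin n → ℂ, ∑ i, (a i : ℂ) * (R *ᵥ v) i = ∑ i, (a i : ℂ) * v i)
    (hR1 : ∀ c : ℂ, R *ᵥ (fun _ => c) = fun _ => c)
    (hC1 : ∀ v : Fin n → ℂ, ∑ i, (C *ᵥ v) i = ∑ i, v i)
    (hCb : ∀ c : ℂ, C *ᵥ (fun i => c * b i) = fun i => c * b i)
    (hr0 : 0 ≤ r) (hr1 : r < 1) (hK : 1 ≤ K) (hz : 1 ≤ ‖z‖) (hz1 : z ≠ 1)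
    (hRr : ∀ v : Fin n → ℂ, ∑ i, (a i : ℂ) * v i = 0 →
      (‖z‖ - r) * ‖v‖ ≤ K * ‖z • v - R *ᵥ v‖)
    (hCr : ∀ v : Fin n → ℂ, ∑ i, v i = 0 →
      (‖z‖ - r) * ∑ i, ‖v i‖ ≤ K * ∑ i, ‖(z • v - C *ᵥ v) i‖)
    (hε : 0 < ε) (hsmall : 20 * n * K ^ 2 * ε ≤ (1 - r) ^ 2) {y w : Fin n → ℂ}
    (hy : z • y - C *ᵥ y = w) (hw : z • w - R *ᵥ w = -((ε : ℂ) * (z - 1)) • y) : y = 0 := by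
  have : NeZero n := ⟨hn⟩
  have hδ : 0 < 1 - r := sub_pos.2 hr1
  have hz1' : z - 1 ≠ 0 := sub_ne_zero.2 hz1
  have hm : (1 : ℝ) ≤ n := by exact_mod_cast Nat.one_le_iff_ne_zero.2 hn
  have ha_le : ∀ i, a i ≤ 1 := fun i => ha1 ▸ Finset.single_le_sum (fun j _ => (ha0 j).le)
    (Finset.mem_univ i)
  have hb_le : ∀ i, b i ≤ 1 := fun i => hb1 ▸ Finset.single_le_sum (fun j _ => (hb0 j).le)
    (Finset.mem_univ i)
  have ha1C : ∑ i, (a i : ℂ) = 1 := by exact_mod_cast ha1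
  have hb1C : ∑ i, (b i : ℂ) = 1 := by exact_mod_cast hb1
  set s := ∑ i, y i with hs
  set τ := ∑ i, (a i : ℂ) * w i with hτ
  set β := ∑ i, (a i : ℂ) * y i with hβ
  set p := ∑ i, a i * b i with hp
  have hp0 : 0 < p := Finset.sum_pos (fun i _ => mul_pos (ha0 i) (hb0 i)) Finset.univ_nonempty
  have hp1 : p ≤ 1 := by
    rw [← ha1]
    exact Finset.sum_le_sum fun i _ => mul_le_of_le_one_right (ha0 i).le (hb_le i)
  -- The two scalar relations obtained from the left Perron vectors.
  have hτβ : τ = -(ε : ℂ) * β := by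
    have h := congrArg (fun u : Fin n → ℂ => ∑ i, (a i : ℂ) * u i) hw
    simp only [Pi.sub_apply, Pi.smul_apply, smul_eq_mul, mul_sub, Finset.sum_sub_distrib, haR,
      mul_left_comm (a _ : ℂ), ← Finset.mul_sum] at h
    apply mul_left_cancel₀ hz1'
    linear_combination h
  have hsw : (z - 1) * s = ∑ i, w i := by
    rw [← hy]
    simp only [Pi.sub_apply, Pi.smul_apply, smul_eq_mul, Finset.sum_sub_distrib, hC1,
      ← Finset.mul_sum]
    ring
  set w' : Fin n → ℂ := fun i => w i - τ with hw'
  set y' : Fin n → ℂ := fun i => y i - s * b i with hy'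
  have hw'0 : ∑ i, (a i : ℂ) * w' i = 0 := by
    simp only [hw', mul_sub, Finset.sum_sub_distrib, ← Finset.sum_mul, ha1C]
    rw [← hτ]; ring
  have hy'0 : ∑ i, y' i = 0 := by
    simp only [hy', Finset.sum_sub_distrib, ← Finset.mul_sum, hb1C]
    rw [← hs]; ring
  have hws : ∑ i, w i = n * τ + ∑ i, w' i := by
    simp [hw', Finset.sum_sub_distrib]
  have hw'eq : z • w' - R *ᵥ w' = fun i => -((ε : ℂ) * (z - 1)) * (y i - β) := by
    have h1 : w' = w - fun _ => τ := rfl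
    ext i
    have h2 := congrFun hw i
    rw [h1, mulVec_sub, hR1]
    simp only [Pi.sub_apply, Pi.smul_apply, smul_eq_mul] at h2 ⊢
    linear_combination h2 - (z - 1) * hτβ
  have hy'eq : z • y' - C *ᵥ y' = fun i => τ * (1 - n * b i) + (w' i - (∑ j, w' j) * b i) := by
    have h1 : y' = y - fun i => s * b i := rfl
    ext i
    have h2 := congrFun hy i
    rw [h1, mulVec_sub, hCb]
    simp only [Pi.sub_apply, Pi.smul_apply, smul_eq_mul] at h2 ⊢
    have h3 : w' i = w i - τ := rfl
    rw [h3]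
    linear_combination h2 - (b i : ℂ) * hsw - (b i : ℂ) * hws
  have hβ' : β = s * p + ∑ i, (a i : ℂ) * y' i := by
    simp only [hy', hβ, hp, mul_sub, Finset.sum_sub_distrib]
    push_cast
    rw [Finset.mul_sum, ← sub_eq_iff_eq_add']
    congr 1
    exact Finset.sum_congr rfl fun i _ => by ring
  -- Their norms.
  set Y := ∑ i, ‖y i‖ with hY
  set V := ∑ i, ‖y' i‖ with hV
  have havg : ∀ u : Fin n → ℂ, ‖∑ i, (a i : ℂ) * u i‖ ≤ ∑ i, ‖u i‖ := fun u => by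
    refine (norm_sum_le _ _).trans (Finset.sum_le_sum fun i _ => ?_)
    rw [norm_mul, Complex.norm_real, Real.norm_of_nonneg (ha0 i).le]
    exact mul_le_of_le_one_left (norm_nonneg _) (ha_le i)
  have hY0 : 0 ≤ Y := Finset.sum_nonneg fun i _ => norm_nonneg _
  have hV0 : 0 ≤ V := Finset.sum_nonneg fun i _ => norm_nonneg _
  have hβY : ‖β‖ ≤ Y := havg y
  have hβV : ‖β‖ ≤ ‖s‖ * p + V := by
    rw [hβ']
    refine (norm_add_le _ _).trans (add_le_add ?_ (havg y'))
    rw [norm_mul, Complex.norm_real, Real.norm_of_nonneg hp0.le]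
  have hYSV : Y ≤ ‖s‖ + V := by
    have h1 : ∀ i, ‖y i‖ ≤ ‖s‖ * b i + ‖y' i‖ := fun i => by
      have : y i = s * b i + y' i := by simp [hy']
      rw [this]
      refine (norm_add_le _ _).trans_eq ?_
      rw [norm_mul, Complex.norm_real, Real.norm_of_nonneg (hb0 i).le]
    refine (Finset.sum_le_sum fun i _ => h1 i).trans_eq ?_
    rw [Finset.sum_add_distrib, ← Finset.mul_sum, hb1, mul_one]
  have hτn : ‖τ‖ = ε * ‖β‖ := by
    rw [hτβ, norm_mul, norm_neg, Complex.norm_real, Real.norm_of_nonneg hε.le]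
  have hd : 1 - r ≤ ‖z‖ - r := by linarith
  have hX0 := hRr w' hw'0
  set X := ‖w'‖ with hX
  have hXnn : 0 ≤ X := norm_nonneg _
  have hX0' : (‖z‖ - r) * X ≤ K * (2 * ε * ‖z - 1‖ * Y) := by
    refine hX0.trans (mul_le_mul_of_nonneg_left ?_ (by linarith))
    rw [hw'eq]
    refine (pi_norm_le_iff_of_nonneg (by positivity)).2 fun i => ?_
    rw [norm_mul, norm_neg, norm_mul, Complex.norm_real, Real.norm_of_nonneg hε.le]
    have h1 : ‖y i - β‖ ≤ 2 * Y := by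
      have := norm_sub_le (y i) β
      have h2 : ‖y i‖ ≤ Y := Finset.single_le_sum (f := fun i => ‖y i‖)
        (fun j _ => norm_nonneg _) (Finset.mem_univ i)
      linarith
    calc ε * ‖z - 1‖ * ‖y i - β‖ ≤ ε * ‖z - 1‖ * (2 * Y) :=
          mul_le_mul_of_nonneg_left h1 (by positivity)
      _ = _ := by ring
  have hX1 : (1 - r) * X ≤ K * (2 * ε * ‖z - 1‖ * Y) :=
    (mul_le_mul_of_nonneg_right hd hXnn).trans hX0'
  have hX2 : (1 - r) * X ≤ K * (4 * ε * Y) := by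
    have h1 : (1 - r) * ‖z - 1‖ ≤ 2 * (‖z‖ - r) := by
      have := norm_sub_le z 1
      rw [norm_one] at this
      nlinarith
    have h2 : (‖z‖ - r) * ((1 - r) * X) ≤ (‖z‖ - r) * (K * (4 * ε * Y)) := by
      have h3 := mul_le_mul_of_nonneg_left hX0' hδ.le
      have h4 := mul_le_mul_of_nonneg_right h1 (by positivity : 0 ≤ K * (2 * ε * Y))
      nlinarith
    exact le_of_mul_le_mul_left h2 (by linarith)
  have hwsum : ‖∑ j, w' j‖ ≤ n * X := by
    refine (norm_sum_le _ _).trans ((Finset.sum_le_sum fun i _ => norm_le_pi_norm w' i).trans_eq ?_)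
    simp [hX]
  have hV1 : (1 - r) * V ≤ K * (2 * n * (ε * ‖β‖ + X)) := by
    refine (mul_le_mul_of_nonneg_right hd hV0).trans
      ((hCr y' hy'0).trans (mul_le_mul_of_nonneg_left ?_ (by linarith)))
    rw [hy'eq, ← hτn]
    have h1 : ∀ i, ‖τ * (1 - n * b i) + (w' i - (∑ j, w' j) * b i)‖ ≤
        ‖τ‖ * (1 + n * b i) + (X + n * X * b i) := fun i => by
      refine (norm_add_le _ _).trans (add_le_add ?_ ?_)
      · rw [norm_mul]
        refine mul_le_mul_of_nonneg_left ((norm_sub_le _ _).trans_eq ?_) (norm_nonneg _)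
        rw [norm_one, norm_mul, Complex.norm_natCast, Complex.norm_real,
          Real.norm_of_nonneg (hb0 i).le]
      · refine (norm_sub_le _ _).trans (add_le_add (norm_le_pi_norm w' i) ?_)
        rw [norm_mul, Complex.norm_real, Real.norm_of_nonneg (hb0 i).le]
        exact mul_le_mul_of_nonneg_right hwsum (hb0 i).le
    refine (Finset.sum_le_sum fun i _ => h1 i).trans_eq ?_
    simp only [Finset.sum_add_distrib, ← Finset.mul_sum, hb1, Finset.sum_const, Finset.card_univ,
      Fintype.card_fin, nsmul_eq_mul]
    ring
  set q : ℝ := ε * n * p with hq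
  have hT : ‖z - 1 + q‖ * ‖s‖ ≤ ε * n * V + n * X := by
    have h1 : (z - 1 + q) * s = -(ε : ℂ) * n * ∑ i, (a i : ℂ) * y' i + ∑ i, w' i := by
      rw [hq]; push_cast
      linear_combination hsw + hws + n * hτβ - (ε : ℂ) * n * hβ'
    rw [← norm_mul, h1]
    refine (norm_add_le _ _).trans (add_le_add ?_ hwsum)
    rw [norm_mul, norm_mul, norm_neg, Complex.norm_real, Real.norm_of_nonneg hε.le,
      Complex.norm_natCast]
    exact mul_le_mul_of_nonneg_left (havg y') (by positivity)
  -- The resolvent constant, with the gap `1 - r` divided out.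
  set k := K / (1 - r) with hk
  have hkδ : k * (1 - r) = K := div_mul_cancel₀ K hδ.ne'
  have hk1 : 1 ≤ k := by rw [hk, le_div_iff₀ hδ]; linarith
  have hsm : 20 * n * k ^ 2 * ε ≤ 1 := by
    refine le_of_mul_le_mul_right ?_ (pow_pos hδ 2)
    calc 20 * n * k ^ 2 * ε * (1 - r) ^ 2 = 20 * n * K ^ 2 * ε := by rw [← hkδ]; ring
      _ ≤ 1 * (1 - r) ^ 2 := by rw [one_mul]; exact hsmall
  obtain ⟨hYS, hTS⟩ := perturbation_estimate (m := n) (ε := ε) (k := k) (p := p) (S := ‖s‖)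
    (V := V) (X := X) (B := ‖β‖) (Y := Y) (N := ‖z - 1‖) (T := ‖z - 1 + q‖) hm hε.le hk1 hsm
    hp0.le (norm_nonneg _) hV0 hY0 (norm_nonneg _)
    (le_of_mul_le_mul_left (by rw [← hkδ] at hX1; linarith) hδ)
    (le_of_mul_le_mul_left (by rw [← hkδ] at hX2; linarith) hδ)
    (le_of_mul_le_mul_left (by rw [← hkδ] at hV1; linarith) hδ) hβY hβV hYSV hT
  have hs0 : s = 0 := by
    by_contra hne
    have hspos : 0 < ‖s‖ := norm_pos_iff.2 hne
    have hq1 : q ≤ 1 / 20 := by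
      have h1 : (1 : ℝ) ≤ k ^ 2 := one_le_pow₀ hk1
      have h2 : ε * n ≤ 1 / 20 := by nlinarith [mul_pos hε (by linarith : (0 : ℝ) < n)]
      exact (mul_le_of_le_one_right (by positivity) hp1).trans h2
    exact false_of_norm_sub_one_add_le hz (by positivity) hq1 (le_of_mul_le_mul_right hTS hspos)
  rw [hs0, norm_zero, mul_zero] at hYS
  ext i
  have := (Finset.sum_eq_zero_iff_of_nonneg (fun i _ => norm_nonneg (y i))).1
    (le_antisymm hYS hY0) i (Finset.mem_univ i)
  exact norm_eq_zero.1 this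

end Perturbation

/-! ### Geometric decay of the powers of the deflated matrix -/

section Deflation

open Matrix

variable {n : ℕ}

/-- The matrix of the spectral projection of `augmented Wr Wc ε` for the eigenvalue `1`: it sends a
state `(x, y)` to the state in which every `x^i` is the network average and every `y^i` is zero. -/
noncomputable def consensusProj (n : ℕ) : Matrix (Fin n ⊕ Fin n) (Fin n ⊕ Fin n) ℝ :=
  fromBlocks (of fun _ _ => 1 / (n : ℝ)) (of fun _ _ => 1 / (n : ℝ)) 0 0

/-- The augmented matrix with its eigenvalue `1` removed. -/
noncomputable def deflated (Wr Wc : Matrix (Fin n) (Fin n) ℝ) (ε : ℝ) :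
    Matrix (Fin n ⊕ Fin n) (Fin n ⊕ Fin n) ℝ :=
  augmented Wr Wc ε - consensusProj n

theorem Irred.of_isWeightMatrix {G : Digraph (Fin n)} (hG : StronglyConnected G)
    {W : Matrix (Fin n) (Fin n) ℝ} (hW : IsWeightMatrix G W) : Irred W := fun i j => by
  have h : Relation.ReflTransGen (Function.swap G.Adj) i j := (hG j i).swap
  exact Relation.ReflTransGen.mono (fun a b hab => (hW.2 a b).2 hab) _ _ h

/-- The admissible range of `ε` makes `ε` small against the squared spectral gap. -/
theorem gap_of_lt_epsBar {Wr Wc : Matrix (Fin n) (Fin n) ℝ} (hn : 2 ≤ n)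
    (hr : thirdModulus (augmented Wr Wc 0) ≤ 1) (hr0 : 0 ≤ thirdModulus (augmented Wr Wc 0))
    {ε : ℝ} (hε : ε ∈ Set.Ioo 0 (epsBar Wr Wc)) :
    thirdModulus (augmented Wr Wc 0) < 1 ∧
      20 * n * ((3 : ℝ) ^ (n - 1)) ^ 2 * ε ≤ (1 - thirdModulus (augmented Wr Wc 0)) ^ 2 := by
  obtain ⟨hε0, hε1⟩ := hε
  set δ := 1 - thirdModulus (augmented Wr Wc 0) with hδ
  have hδ0 : 0 ≤ δ := by linarith
  have hδ1 : δ ≤ 1 := by linarith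
  rw [epsBar, ← hδ, one_div, inv_mul_eq_div, lt_div_iff₀ (by positivity)] at hε1
  have hδpos : 0 < δ := by
    rcases hδ0.lt_or_eq with h | h
    · exact h
    · rw [← h, zero_pow (by omega)] at hε1
      exact absurd hε1 (not_lt.2 (by positivity))
  refine ⟨by linarith, ?_⟩
  have h1 : δ ^ n ≤ δ ^ 2 := pow_le_pow_of_le_one hδ0 hδ1 hn
  have hn' : (2 : ℝ) ≤ n := by exact_mod_cast hn
  have h2 : 20 * n * ((3 : ℝ) ^ (n - 1)) ^ 2 ≤ (20 + 8 * (n : ℝ)) ^ n := by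
    obtain ⟨k, rfl⟩ : ∃ k, n = k + 2 := ⟨n - 2, by omega⟩
    rw [show k + 2 - 1 = k + 1 from rfl, show k + 2 = (k + 1) + 1 from rfl]
    set N : ℝ := ((k + 1 + 1 : ℕ) : ℝ)
    have h3 : ((3 : ℝ) ^ (k + 1)) ^ 2 = 9 ^ k * 9 := by
      rw [← pow_mul, mul_comm, pow_mul, ← pow_succ]; norm_num
    have h4 : (9 : ℝ) ^ k ≤ (20 + 8 * N) ^ k :=
      pow_le_pow_left₀ (by norm_num) (by linarith) k
    have h5 : 20 * N * 9 ≤ (20 + 8 * N) * (20 + 8 * N) := by nlinarith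
    rw [h3, pow_succ, pow_succ]
    calc 20 * N * (9 ^ k * 9) = 9 ^ k * (20 * N * 9) := by ring
      _ ≤ (20 + 8 * N) ^ k * ((20 + 8 * N) * (20 + 8 * N)) :=
        mul_le_mul h4 h5 (by positivity) (by positivity)
      _ = _ := by ring
  calc 20 * n * ((3 : ℝ) ^ (n - 1)) ^ 2 * ε ≤ (20 + 8 * (n : ℝ)) ^ n * ε :=
        mul_le_mul_of_nonneg_right h2 hε0.le
    _ ≤ δ ^ n := by linarith
    _ ≤ δ ^ 2 := h1

/-- The coordinate sum is preserved by the augmented matrix and annihilated by the deflated one, so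
an eigenvector of the latter for an eigenvalue `z ≠ 0` has coordinate sum zero and satisfies the
eigenvalue equations of the augmented matrix. -/
theorem deflated_mulVec_eq {Wr Wc : Matrix (Fin n) (Fin n) ℝ} {ε : ℝ} {z : ℂ}
    {v : Fin n ⊕ Fin n → ℂ} (hn : n ≠ 0) (hz : z ≠ 0) (hc : ColSumsOne Wc)
    (hv : (deflated Wr Wc ε).map (algebraMap ℝ ℂ) *ᵥ v = z • v) :
    (∑ i, v (Sum.inl i) + ∑ i, v (Sum.inr i) = 0) ∧
    (∀ i, (Wr.map (algebraMap ℝ ℂ) *ᵥ (v ∘ Sum.inl)) i + ε * v (Sum.inr i) = z * v (Sum.inl i)) ∧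
    (∀ i, v (Sum.inl i) - (Wr.map (algebraMap ℝ ℂ) *ᵥ (v ∘ Sum.inl)) i +
      (Wc.map (algebraMap ℝ ℂ) *ᵥ (v ∘ Sum.inr)) i - ε * v (Sum.inr i) = z * v (Sum.inr i)) := by
  set S : ℂ := ∑ i, v (Sum.inl i) + ∑ i, v (Sum.inr i) with hS
  have hn' : (n : ℂ) ≠ 0 := Nat.cast_ne_zero.2 hn
  have hblock : (deflated Wr Wc ε).map (algebraMap ℝ ℂ) =
      fromBlocks (Wr.map (algebraMap ℝ ℂ) - of fun _ _ => 1 / (n : ℂ))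
        ((ε : ℂ) • 1 - of fun _ _ => 1 / (n : ℂ)) (1 - Wr.map (algebraMap ℝ ℂ))
        (Wc.map (algebraMap ℝ ℂ) - (ε : ℂ) • 1) := by
    ext (i | i) (j | j) <;> by_cases hij : i = j <;>
      simp [deflated, augmented, consensusProj, hij]
  have hJ : ∀ (u : Fin n → ℂ) (i : Fin n),
      ((of fun _ _ => 1 / (n : ℂ) : Matrix (Fin n) (Fin n) ℂ) *ᵥ u) i = (∑ j, u j) / n := by
    intro u i
    simp only [mulVec, dotProduct, of_apply, ← Finset.mul_sum]
    ring
  rw [hblock, fromBlocks_mulVec] at hv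
  have h1 : ∀ i, (Wr.map (algebraMap ℝ ℂ) *ᵥ (v ∘ Sum.inl)) i + ε * v (Sum.inr i) - S / n =
      z * v (Sum.inl i) := by
    intro i
    have := congrFun hv (Sum.inl i)
    simp only [Sum.elim_inl, sub_mulVec, smul_mulVec, one_mulVec, Pi.add_apply, Pi.sub_apply,
      Pi.smul_apply, smul_eq_mul, hJ, Function.comp_apply] at this
    rw [← this, hS, add_div]
    ring
  have h2 : ∀ i, v (Sum.inl i) - (Wr.map (algebraMap ℝ ℂ) *ᵥ (v ∘ Sum.inl)) i +
      (Wc.map (algebraMap ℝ ℂ) *ᵥ (v ∘ Sum.inr)) i - ε * v (Sum.inr i) = z * v (Sum.inr i) := by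
    intro i
    have := congrFun hv (Sum.inr i)
    simp only [Sum.elim_inr, sub_mulVec, smul_mulVec, one_mulVec, Pi.add_apply, Pi.sub_apply,
      Pi.smul_apply, smul_eq_mul, Function.comp_apply] at this
    rw [← this]
    ring
  have hcol : ∑ i, (Wc.map (algebraMap ℝ ℂ) *ᵥ (v ∘ Sum.inr)) i = ∑ i, v (Sum.inr i) := by
    simp only [mulVec, dotProduct]
    rw [Finset.sum_comm]
    refine Finset.sum_congr rfl fun j _ => ?_
    have := congrArg (algebraMap ℝ ℂ) (hc j)
    rw [map_sum, map_one] at this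
    simp only [map_apply, ← Finset.sum_mul, this, one_mul, Function.comp]
  have hS0 : S = 0 := by
    have e1 := Finset.sum_congr (rfl : (Finset.univ : Finset (Fin n)) = _) fun i _ => h1 i
    have e2 := Finset.sum_congr (rfl : (Finset.univ : Finset (Fin n)) = _) fun i _ => h2 i
    simp only [Finset.sum_sub_distrib, Finset.sum_add_distrib, ← Finset.mul_sum, hcol,
      Finset.sum_const, Finset.card_univ, Fintype.card_fin, nsmul_eq_mul] at e1 e2
    rw [mul_div_cancel₀ _ hn'] at e1
    have : z * S = 0 := by rw [hS] at e1 ⊢; linear_combination -e1 - e2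
    exact (mul_eq_zero.1 this).resolve_left hz
  refine ⟨hS0, fun i => ?_, h2⟩
  have := h1 i
  rwa [hS0, zero_div, sub_zero] at this

/-- All eigenvalues of the deflated matrix lie in the open unit disc. -/
theorem deflated_eigenvector_eq_zero (hn : 2 ≤ n) {G : Digraph (Fin n)} (hG : StronglyConnected G)
    {Wr Wc : Matrix (Fin n) (Fin n) ℝ} (hWr : IsWeightMatrix G Wr) (hWr1 : RowSumsOne Wr)
    (hWc : IsWeightMatrix G Wc) (hWc1 : ColSumsOne Wc) {ε : ℝ}
    (hε : ε ∈ Set.Ioo 0 (epsBar Wr Wc)) {z : ℂ} (hz : 1 ≤ ‖z‖) {v : Fin n ⊕ Fin n → ℂ}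
    (hv : (deflated Wr Wc ε).map (algebraMap ℝ ℂ) *ᵥ v = z • v) : v = 0 := by
  have hn0 : n ≠ 0 := by omega
  have : NeZero n := ⟨hn0⟩
  have hr_irr := Irred.of_isWeightMatrix hG hWr
  have hc_irr := Irred.of_isWeightMatrix hG hWc
  obtain ⟨hr0, hr1, ⟨s, hs, hscard, hsr⟩, ⟨t, ht, htcard, htr⟩⟩ :=
    exists_roots_le_thirdModulus hn0 hWr.1 hWr1 hWc.1 hWc1
  obtain ⟨hlt, hsmall⟩ := gap_of_lt_epsBar hn hr1 hr0 hε
  have hε0 : 0 < ε := hε.1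
  have hεC : (ε : ℂ) ≠ 0 := by exact_mod_cast hε0.ne'
  -- Perron vectors.
  have hWc_one : (fun _ => (1 : ℝ)) ᵥ* Wc = fun _ => 1 := by
    ext j; simpa [vecMul, dotProduct] using hWc1 j
  have hWr_one : (fun _ => (1 : ℝ)) ᵥ* Wrᵀ = fun _ => 1 := by
    ext j; simpa [vecMul, dotProduct] using hWr1 j
  obtain ⟨a, ha0, ha1, haW⟩ := exists_pos_fixed (A := Wrᵀ) (fun i j => hWr.1 j i) hr_irr.transpose
    (fun _ => one_pos) hWr_one
  rw [mulVec_transpose] at haW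
  obtain ⟨b, hb0, hb1, hbW⟩ := exists_pos_fixed hWc.1 hc_irr (fun _ => one_pos) hWc_one
  have ha1C : ∑ i, (a i : ℂ) = 1 := by exact_mod_cast ha1
  have hb1C : ∑ i, (b i : ℂ) = 1 := by exact_mod_cast hb1
  set R := Wr.map (algebraMap ℝ ℂ) with hR
  set C := Wc.map (algebraMap ℝ ℂ) with hC
  have haR : ∀ u : Fin n → ℂ, ∑ i, (a i : ℂ) * (R *ᵥ u) i = ∑ i, (a i : ℂ) * u i := by
    intro u
    have h1 : (fun i => (a i : ℂ)) ᵥ* R = fun i => (a i : ℂ) := by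
      ext j
      have := congrArg (algebraMap ℝ ℂ) (congrFun haW j)
      simpa [vecMul, dotProduct, hR] using this
    change (fun i => (a i : ℂ)) ⬝ᵥ (R *ᵥ u) = (fun i => (a i : ℂ)) ⬝ᵥ u
    rw [dotProduct_mulVec, h1]
  have hC1 : ∀ u : Fin n → ℂ, ∑ i, (C *ᵥ u) i = ∑ i, u i := by
    intro u
    have h1 : (fun _ => (1 : ℂ)) ᵥ* C = fun _ => 1 := by
      ext j
      have := congrArg (algebraMap ℝ ℂ) (hWc1 j)
      simpa [vecMul, dotProduct, hC] using this
    have h2 := dotProduct_mulVec (fun _ => (1 : ℂ)) C u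
    rw [h1] at h2
    simpa [dotProduct] using h2
  have hR1 : ∀ c : ℂ, R *ᵥ (fun _ => c) = fun _ => c := by
    intro c
    ext i
    have := congrArg (algebraMap ℝ ℂ) (hWr1 i)
    rw [map_sum, map_one] at this
    simp only [mulVec, dotProduct, hR, map_apply, ← Finset.sum_mul, this, one_mul]
  have hCb : ∀ c : ℂ, C *ᵥ (fun i => c * b i) = fun i => c * b i := by
    intro c
    ext i
    have := congrArg (algebraMap ℝ ℂ) (congrFun hbW i)
    simp only [mulVec, dotProduct, map_sum, map_mul] at this
    simp only [mulVec, dotProduct, hC, map_apply, mul_left_comm _ c, ← Finset.mul_sum]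
    rw [← Complex.coe_algebraMap, ← this]
  have hone : ∀ u : Fin n → ℂ, ∑ i, ((1 : ℝ) : ℂ) * u i = ∑ i, u i := by simp
  have hz0 : z ≠ 0 := fun h => by rw [h, norm_zero] at hz; linarith
  obtain ⟨hsum, hx, hy⟩ := deflated_mulVec_eq hn0 hz0 hWc1 hv
  set x : Fin n → ℂ := v ∘ Sum.inl with hxdef
  set y : Fin n → ℂ := v ∘ Sum.inr with hydef
  change ∑ i, x i + ∑ i, y i = 0 at hsum
  change ∀ i, (R *ᵥ x) i + ε * y i = z * x i at hx
  change ∀ i, x i - (R *ᵥ x) i + (C *ᵥ y) i - ε * y i = z * y i at hy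
  suffices hxy : x = 0 ∧ y = 0 by
    ext (i | i)
    · exact congrFun hxy.1 i
    · exact congrFun hxy.2 i
  by_cases hz1 : z = 1
  · subst hz1
    have hCy : C *ᵥ y = y := by
      ext i; linear_combination hx i + hy i
    have hyb : y = fun i => (∑ j, y j) * b i := by
      have h0 : y - (fun i => (∑ j, y j) * (b i : ℂ)) = 0 := by
        refine eq_zero_of_map_mulVec_eq hWc.1 hc_irr (fun _ => one_pos) hWc_one ?_ ?_
        · rw [← hC, mulVec_sub, hCb, hCy]
        · rw [hone]
          simp only [Pi.sub_apply, Finset.sum_sub_distrib, ← Finset.mul_sum, hb1C, mul_one,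
            sub_self]
      exact sub_eq_zero.1 h0
    have hay : ∑ i, (a i : ℂ) * y i = 0 := by
      have h1 : ∑ i, (a i : ℂ) * ((R *ᵥ x) i + ε * y i) = ∑ i, (a i : ℂ) * x i :=
        Finset.sum_congr rfl fun i _ => by rw [hx i, one_mul]
      simp only [mul_add, Finset.sum_add_distrib, haR, mul_left_comm (a _ : ℂ),
        ← Finset.mul_sum] at h1
      exact (mul_eq_zero.1 (add_eq_left.1 h1)).resolve_left hεC
    have hysum : ∑ j, y j = 0 := by
      rw [hyb] at hay
      simp only [mul_left_comm (a _ : ℂ), ← Finset.mul_sum] at hay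
      refine (mul_eq_zero.1 hay).resolve_right ?_
      have hpos : 0 < ∑ i, a i * b i :=
        Finset.sum_pos (fun i _ => mul_pos (ha0 i) (hb0 i)) Finset.univ_nonempty
      exact_mod_cast hpos.ne'
    have hy0 : y = 0 := by
      rw [hyb, hysum]; ext i; simp
    have hRx : R *ᵥ x = x := by
      ext i
      have := hx i
      rw [hy0] at this
      simpa using this
    have hxa : x = fun _ => ∑ j, (a j : ℂ) * x j := by
      have h0 : x - (fun _ => ∑ j, (a j : ℂ) * x j) = 0 := by
        refine eq_zero_of_map_mulVec_eq hWr.1 hr_irr ha0 haW ?_ ?_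
        · rw [← hR, mulVec_sub, hR1, hRx]
        · simp only [Pi.sub_apply, mul_sub, Finset.sum_sub_distrib, ← Finset.sum_mul, ha1C,
            one_mul, sub_self]
      exact sub_eq_zero.1 h0
    have hxs : ∑ j, (a j : ℂ) * x j = 0 := by
      have h1 : ∑ i, x i = n * ∑ j, (a j : ℂ) * x j := by
        conv_lhs => rw [hxa]
        simp
      rw [hysum, add_zero, h1] at hsum
      exact (mul_eq_zero.1 hsum).resolve_left (Nat.cast_ne_zero.2 hn0)
    refine ⟨?_, hy0⟩
    rw [hxa, hxs]; rfl
  · have hw : ∀ i, (z • y - C *ᵥ y) i = -(z - 1) * x i := fun i => by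
      simp only [Pi.sub_apply, Pi.smul_apply, smul_eq_mul]
      linear_combination -hx i - hy i
    have hweq : z • y - C *ᵥ y = -(z - 1) • x := by
      ext i; rw [hw i]; rfl
    have hy0 : y = 0 := by
      refine eq_zero_of_pencil (R := R) (C := C) (K := 3 ^ (n - 1)) hn0 ha0 ha1 hb0 hb1 haR hR1 hC1
        hCb hr0 hlt (one_le_pow₀ (by norm_num)) hz hz1 ?_ ?_ hε0 hsmall hweq ?_
      · intro u hu
        have := resolvent_bound_of_irred hWr.1 hr_irr ha0 haW (LinearEquiv.refl ℂ _)
          (fun u => norm_mulVec_le_of_rowSumsOne hWr.1 hWr1 u) hs hlt hsr hz u hu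
        rwa [hscard] at this
      · intro u hu
        have hnorm : ∀ u : Fin n → ℂ, ‖(WithLp.linearEquiv 1 ℂ (Fin n → ℂ)).symm u‖ = ∑ i, ‖u i‖ :=
          fun u => by rw [PiLp.norm_eq_of_L1]; rfl
        have := resolvent_bound_of_irred hWc.1 hc_irr (fun _ => one_pos) hWc_one
          (WithLp.linearEquiv 1 ℂ (Fin n → ℂ)).symm
          (fun u => by
            rw [hnorm, hnorm]; exact sum_norm_mulVec_le_of_colSumsOne hWc.1 hWc1 u)
          ht hlt htr hz u (by rw [hone]; exact hu)
        rwa [htcard, hnorm, hnorm] at this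
      · ext i
        rw [mulVec_smul]
        simp only [Pi.sub_apply, Pi.smul_apply, smul_eq_mul]
        linear_combination (z - 1) * hx i
    refine ⟨?_, hy0⟩
    rw [hy0, smul_zero, mulVec_zero, sub_zero] at hweq
    exact (smul_eq_zero.1 hweq.symm).resolve_left (neg_ne_zero.2 (sub_ne_zero.2 hz1))

theorem exists_le_const_mul_pow {a : ℕ → ℝ} (ha : ∀ k, 0 ≤ a k) {ρ : ℝ} (hρ : 0 < ρ) {N : ℕ}
    (h : ∀ k, N ≤ k → a k ≤ ρ ^ k) : ∃ C : ℝ, 0 ≤ C ∧ ∀ k, a k ≤ C * ρ ^ k := by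
  have hd : ∀ k, 0 ≤ a k / ρ ^ k := fun k => div_nonneg (ha k) (pow_pos hρ k).le
  have hs : 0 ≤ ∑ k ∈ Finset.range N, a k / ρ ^ k := Finset.sum_nonneg fun k _ => hd k
  refine ⟨1 + ∑ k ∈ Finset.range N, a k / ρ ^ k, by linarith, fun k => ?_⟩
  rw [← div_le_iff₀ (pow_pos hρ k)]
  rcases le_or_gt N k with hk | hk
  · have := (div_le_one (pow_pos hρ k)).2 (h k hk)
    linarith
  · have := Finset.single_le_sum (f := fun k => a k / ρ ^ k) (fun k _ => hd k)
      (Finset.mem_range.2 hk)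
    linarith

section Gelfand

attribute [local instance] Matrix.linftyOpNormedAddCommGroup Matrix.linftyOpNormedRing
  Matrix.linftyOpNormedAlgebra

/-- If all complex eigenvalues lie in the open unit disc, the entries of the powers decay
geometrically (Gelfand's formula). -/
theorem exists_geometric_bound {ι : Type*} [Fintype ι] [DecidableEq ι] (B : Matrix ι ι ℝ)
    (h : ∀ z : ℂ, 1 ≤ ‖z‖ → ∀ v : ι → ℂ, B.map (algebraMap ℝ ℂ) *ᵥ v = z • v → v = 0) :
    ∃ ρ C : ℝ, 0 < ρ ∧ ρ < 1 ∧ 0 ≤ C ∧ ∀ k i j, |(B ^ k) i j| ≤ C * ρ ^ k := by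
  rcases isEmpty_or_nonempty ι with hι | hι
  · exact ⟨1 / 2, 0, by norm_num, by norm_num, le_rfl, fun k i => hι.elim i⟩
  set M := B.map (algebraMap ℝ ℂ) with hM
  have : CompleteSpace (Matrix ι ι ℂ) := FiniteDimensional.complete ℂ _
  have hspec : spectralRadius ℂ M < ((1 : NNReal) : ENNReal) := by
    refine spectrum.spectralRadius_lt_of_forall_lt M fun z hz => ?_
    by_contra hc
    have hz1 : 1 ≤ ‖z‖ := by exact_mod_cast not_lt.1 hc
    rw [← Matrix.spectrum_toLin', ← Module.End.hasEigenvalue_iff_mem_spectrum] at hz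
    obtain ⟨v, hv⟩ := hz.exists_hasEigenvector
    refine hv.2 (h z hz1 v ?_)
    simpa [Matrix.toLin'_apply] using hv.apply_eq_smul
  obtain ⟨ρ, hρ1, hρ2⟩ := ENNReal.lt_iff_exists_nnreal_btwn.1 hspec
  have hρ0 : 0 < ρ := by
    have : (0 : ENNReal) < ρ := bot_le.trans_lt hρ1
    exact_mod_cast this
  have hev := (spectrum.pow_nnnorm_pow_one_div_tendsto_nhds_spectralRadius M).eventually_lt_const hρ1
  obtain ⟨N, hN⟩ := eventually_atTop.1 (hev.and (eventually_ge_atTop 1))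
  have hbig : ∀ k, N ≤ k → ‖M ^ k‖ ≤ (ρ : ℝ) ^ k := by
    intro k hk
    obtain ⟨h1, h2⟩ := hN k hk
    have hk0 : (k : ℝ) ≠ 0 := by positivity
    have h3 := ENNReal.rpow_le_rpow h1.le (Nat.cast_nonneg k : (0 : ℝ) ≤ k)
    rw [← ENNReal.rpow_mul, one_div, inv_mul_cancel₀ hk0, ENNReal.rpow_one,
      ENNReal.rpow_natCast] at h3
    exact_mod_cast h3
  have hρpos : (0 : ℝ) < ρ := by exact_mod_cast hρ0
  obtain ⟨C, hC0, hC⟩ := exists_le_const_mul_pow (fun k => norm_nonneg (M ^ k)) hρpos hbig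
  refine ⟨ρ, C, hρpos, by exact_mod_cast hρ2, hC0, fun k i j => ?_⟩
  have hentry : |(B ^ k) i j| ≤ ‖M ^ k‖ := by
    have h1 : (M ^ k) i j = (((B ^ k) i j : ℝ) : ℂ) := by
      have : M ^ k = (B ^ k).map (algebraMap ℝ ℂ) := by
        rw [hM]; exact (map_pow (algebraMap ℝ ℂ).mapMatrix B k).symm
      rw [this]; rfl
    have h2 : ‖(M ^ k) i j‖ = |(B ^ k) i j| := by rw [h1, Complex.norm_real, Real.norm_eq_abs]
    rw [← h2, Matrix.linfty_opNorm_def]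
    have h3 : ‖(M ^ k) i j‖₊ ≤ ∑ j, ‖(M ^ k) i j‖₊ :=
      Finset.single_le_sum (f := fun j => ‖(M ^ k) i j‖₊) (fun _ _ => zero_le) (Finset.mem_univ j)
    have h4 := h3.trans (Finset.le_sup (f := fun i => ∑ j, ‖(M ^ k) i j‖₊) (Finset.mem_univ i))
    exact_mod_cast h4
  exact hentry.trans (hC k)

end Gelfand

end Deflation

/-! ### Scalar recursions -/

/-- The solution of `u (k + 1) = ρ * u k + b k` with initial value `u₀`. -/
def scalarRec (ρ u₀ : ℝ) (b : ℕ → ℝ) : ℕ → ℝ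
  | 0 => u₀
  | k + 1 => ρ * scalarRec ρ u₀ b k + b k

/-- By convexity of the square, `u (k + 1) ^ 2 ≤ ρ * u k ^ 2 + b k ^ 2 / (1 - ρ)`, so a square
summable input has a square summable response. -/
theorem summable_scalarRec_sq {ρ u₀ : ℝ} {b : ℕ → ℝ} (hρ0 : 0 ≤ ρ) (hρ1 : ρ < 1)
    (hb : Summable fun k => b k ^ 2) : Summable fun k => scalarRec ρ u₀ b k ^ 2 := by
  set u := scalarRec ρ u₀ b with hu
  have hδ : 0 < 1 - ρ := sub_pos.2 hρ1
  set T := ∑' k, b k ^ 2 with hT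
  have hstep : ∀ k, u (k + 1) ^ 2 ≤ ρ * u k ^ 2 + b k ^ 2 / (1 - ρ) := by
    intro k
    have h1 : u (k + 1) = ρ * u k + b k := rfl
    have h2 : ρ * u k ^ 2 + b k ^ 2 / (1 - ρ) - u (k + 1) ^ 2 =
        ρ / (1 - ρ) * ((1 - ρ) * u k - b k) ^ 2 := by
      rw [h1]; field_simp; ring
    have h3 : 0 ≤ ρ / (1 - ρ) * ((1 - ρ) * u k - b k) ^ 2 := by positivity
    linarith
  refine summable_of_sum_range_le (c := (u₀ ^ 2 + T / (1 - ρ)) / (1 - ρ)) (fun k => sq_nonneg _) ?_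
  have hT0 : 0 ≤ T := tsum_nonneg fun k => sq_nonneg _
  intro N
  induction N with
  | zero => rw [Finset.sum_range_zero]; positivity
  | succ N ih =>
    rw [Finset.sum_range_succ']
    have h0 : u 0 = u₀ := rfl
    have h1 : ∑ k ∈ Finset.range N, u (k + 1) ^ 2 ≤
        ρ * ∑ k ∈ Finset.range N, u k ^ 2 + T / (1 - ρ) := by
      refine (Finset.sum_le_sum fun k _ => hstep k).trans ?_
      rw [Finset.sum_add_distrib, ← Finset.mul_sum, ← Finset.sum_div]
      gcongr
      exact hb.sum_le_tsum _ fun k _ => sq_nonneg _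
    have h2 := mul_le_mul_of_nonneg_left ih hρ0
    have h3 : (u₀ ^ 2 + T / (1 - ρ)) / (1 - ρ) =
        ρ * ((u₀ ^ 2 + T / (1 - ρ)) / (1 - ρ)) + (u₀ ^ 2 + T / (1 - ρ)) := by
      field_simp; ring
    rw [h0, h3]
    linarith

theorem tendsto_scalarRec {ρ u₀ : ℝ} {b : ℕ → ℝ} (hρ0 : 0 ≤ ρ) (hρ1 : ρ < 1)
    (hb : Summable fun k => b k ^ 2) : Tendsto (scalarRec ρ u₀ b) atTop (𝓝 0) := by
  have h := (summable_scalarRec_sq (u₀ := u₀) hρ0 hρ1 hb).tendsto_atTop_zero.sqrt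
  simp only [Real.sqrt_sq_eq_abs, Real.sqrt_zero] at h
  exact (tendsto_zero_iff_abs_tendsto_zero _).2 h

/-! ### The recursion of the consensus error -/

section Action

variable {ι F : Type*} [Fintype ι] [NormedAddCommGroup F] [NormedSpace ℝ F]

/-- The action of a real matrix on families of vectors. -/
def act (B : Matrix ι ι ℝ) (v : ι → F) : ι → F := fun i => ∑ j, B i j • v j

theorem act_mul (A B : Matrix ι ι ℝ) (v : ι → F) : act (A * B) v = act A (act B v) := by
  ext i
  simp only [act, Matrix.mul_apply, Finset.sum_smul, Finset.smul_sum, mul_smul]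
  rw [Finset.sum_comm]

theorem act_one [DecidableEq ι] (v : ι → F) : act (1 : Matrix ι ι ℝ) v = v := by
  ext i
  simp [act, Matrix.one_apply, ite_smul]

theorem act_sub_smul (A : Matrix ι ι ℝ) (v w : ι → F) (c : ℝ) :
    act A (v - c • w) = act A v - c • act A w := by
  ext i
  simp only [act, Pi.sub_apply, Pi.smul_apply, smul_sub, Finset.sum_sub_distrib, Finset.smul_sum,
    smul_comm c]

theorem norm_act_le {A : Matrix ι ι ℝ} {c : ℝ} (hA : ∀ i j, |A i j| ≤ c) (v : ι → F) (i : ι) :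
    ‖act A v i‖ ≤ c * ∑ j, ‖v j‖ := by
  rw [Finset.mul_sum]
  refine (norm_sum_le _ _).trans (Finset.sum_le_sum fun j _ => ?_)
  rw [norm_smul, Real.norm_eq_abs]
  exact mul_le_mul_of_nonneg_right (hA i j) (norm_nonneg _)

/-- An error driven by a matrix with geometrically decaying powers is dominated by a scalar
recursion. The bound is proved for all the vectors `B ^ j` applied to the error at once. -/
theorem norm_act_pow_le_scalarRec [DecidableEq ι] {B : Matrix ι ι ℝ} {ρ C : ℝ}
    (hB : ∀ k i j, |(B ^ k) i j| ≤ C * ρ ^ k) (hρ : 0 < ρ) (hC : 0 ≤ C) {e g : ℕ → ι → F}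
    {α G : ℕ → ℝ} (hα : ∀ k, 0 ≤ α k) (he : ∀ k, e (k + 1) = act B (e k) - α k • g k)
    (hg : ∀ k, ∑ j, ‖g k j‖ ≤ G k) (k j : ℕ) (i : ι) :
    ‖act (B ^ j) (e k) i‖ ≤
      ρ ^ j * scalarRec ρ (C * ∑ j, ‖e 0 j‖) (fun k => C * (α k * G k)) k := by
  induction k generalizing j with
  | zero =>
    refine (norm_act_le (hB j) (e 0) i).trans_eq ?_
    simp only [scalarRec]; ring
  | succ k ih =>
    rw [he, act_sub_smul, ← act_mul, ← pow_succ]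
    refine (norm_sub_le _ _).trans ?_
    rw [Pi.smul_apply, norm_smul, Real.norm_of_nonneg (hα k)]
    have h1 := ih (j + 1)
    have h2 : α k * ‖act (B ^ j) (g k) i‖ ≤ α k * (C * ρ ^ j * G k) :=
      mul_le_mul_of_nonneg_left ((norm_act_le (hB j) (g k) i).trans
        (mul_le_mul_of_nonneg_left (hg k) (by positivity))) (hα k)
    refine (add_le_add h1 h2).trans_eq ?_
    simp only [scalarRec]; ring

end Action

section Deviation

open Matrix

variable {n m : ℕ}

theorem one_sub_consensusProj_mul (hn : n ≠ 0) {Wr Wc : Matrix (Fin n) (Fin n) ℝ}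
    (hr : RowSumsOne Wr) (hc : ColSumsOne Wc) (ε : ℝ) :
    (1 - consensusProj n) * augmented Wr Wc ε = deflated Wr Wc ε * (1 - consensusProj n) := by
  have hn' : (n : ℝ) ≠ 0 := Nat.cast_ne_zero.2 hn
  set J : Matrix (Fin n) (Fin n) ℝ := of fun _ _ => 1 / (n : ℝ) with hJ
  have hJJ : J * J = J := by
    ext i j; simp [hJ, mul_apply, hn']
  have hJc : J * Wc = J := by
    ext i j
    simp only [hJ, mul_apply, of_apply, ← Finset.mul_sum, hc j, mul_one]
  have hrJ : Wr * J = J := by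
    ext i j
    simp only [hJ, mul_apply, of_apply, ← Finset.sum_mul, hr i, one_mul]
  have hP : consensusProj n = fromBlocks J J 0 0 := rfl
  have hPP : consensusProj n * consensusProj n = consensusProj n := by
    rw [hP, fromBlocks_multiply]; simp [hJJ]
  have hPM : consensusProj n * augmented Wr Wc ε = consensusProj n := by
    rw [hP, augmented, fromBlocks_multiply]
    simp [mul_sub, hJc]
  have hMP : augmented Wr Wc ε * consensusProj n = consensusProj n := by
    rw [hP, augmented, fromBlocks_multiply]
    simp [sub_mul, hrJ]
  rw [deflated, sub_mul, mul_sub, sub_mul, one_mul, mul_one, hPM, sub_mul, hMP, hPP]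
  simp

/-- The deviation of a state, in both families, from the projected state. -/
noncomputable def deviation
    (s : (Fin n → EuclideanSpace ℝ (Fin m)) × (Fin n → EuclideanSpace ℝ (Fin m))) :
    Fin n ⊕ Fin n → EuclideanSpace ℝ (Fin m) :=
  act (1 - consensusProj n) (Sum.elim s.1 s.2)

theorem deviation_inl
    (s : (Fin n → EuclideanSpace ℝ (Fin m)) × (Fin n → EuclideanSpace ℝ (Fin m))) (i : Fin n) :
    deviation s (Sum.inl i) = consensusError s i := by
  simp [deviation, act, consensusError, average, consensusProj, Matrix.one_apply, sub_smul,
    Finset.sum_sub_distrib, Finset.smul_sum, ite_smul]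

theorem deviation_iter_succ (hn : n ≠ 0) {Wr Wc : Matrix (Fin n) (Fin n) ℝ}
    (hr : RowSumsOne Wr) (hc : ColSumsOne Wc) (ε : ℝ) (α : ℕ → ℝ) (μ : ℝ)
    (f : Fin n → EuclideanSpace ℝ (Fin m) → ℝ) (x0 y0 : Fin n → EuclideanSpace ℝ (Fin m))
    (z : ℕ → Fin n → EuclideanSpace ℝ (Fin m)) (k : ℕ) :
    deviation (iter Wr Wc ε α μ f x0 y0 z (k + 1)) =
      act (deflated Wr Wc ε) (deviation (iter Wr Wc ε α μ f x0 y0 z k)) -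
        α k • act (1 - consensusProj n) (Sum.elim
          (fun i => oracle (f i) μ ((iter Wr Wc ε α μ f x0 y0 z k).1 i) (z k i)) 0) := by
  set s := iter Wr Wc ε α μ f x0 y0 z k with hs
  have hstep : Sum.elim (iter Wr Wc ε α μ f x0 y0 z (k + 1)).1
      (iter Wr Wc ε α μ f x0 y0 z (k + 1)).2 =
      act (augmented Wr Wc ε) (Sum.elim s.1 s.2) -
        α k • Sum.elim (fun i => oracle (f i) μ (s.1 i) (z k i)) 0 := by
    ext1 (i | i)
    · simp [act, augmented, iter, ← hs, Matrix.one_apply, ite_smul]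
    · simp [act, augmented, iter, ← hs, Matrix.one_apply, sub_smul, ite_smul,
        Finset.sum_sub_distrib]
      abel
  rw [deviation, hstep, act_sub_smul, ← act_mul, one_sub_consensusProj_mul hn hr hc, act_mul]
  rfl

theorem norm_oracle_le {f : EuclideanSpace ℝ (Fin m) → ℝ} {D μ : ℝ}
    (hf : ∀ x y, |f x - f y| ≤ D * ‖x - y‖) (hμ : 0 < μ) (x z : EuclideanSpace ℝ (Fin m)) :
    ‖oracle f μ x z‖ ≤ D * ‖z‖ ^ 2 := by
  rw [oracle, norm_smul, norm_div, Real.norm_eq_abs, Real.norm_of_nonneg hμ.le]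
  have h := hf (x + μ • z) x
  rw [add_sub_cancel_left, norm_smul, Real.norm_of_nonneg hμ.le] at h
  have h2 : |f (x + μ • z) - f x| / μ ≤ D * ‖z‖ := by
    rw [div_le_iff₀ hμ]; linarith
  calc |f (x + μ • z) - f x| / μ * ‖z‖ ≤ D * ‖z‖ * ‖z‖ :=
        mul_le_mul_of_nonneg_right h2 (norm_nonneg _)
    _ = D * ‖z‖ ^ 2 := by ring

/-- Along every realisation, the consensus errors are dominated by a scalar recursion driven by the
step sizes times the squared norms of the random directions. -/
theorem exists_norm_consensusError_le (hn : 2 ≤ n) {G : Digraph (Fin n)} (hG : StronglyConnected G)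
    {Wr Wc : Matrix (Fin n) (Fin n) ℝ} (hWr : IsWeightMatrix G Wr) (hWr1 : RowSumsOne Wr)
    (hWc : IsWeightMatrix G Wc) (hWc1 : ColSumsOne Wc)
    {f : Fin n → EuclideanSpace ℝ (Fin m) → ℝ} {D : ℝ}
    (hlip : ∀ i x y, |f i x - f i y| ≤ D * ‖x - y‖) {μ : ℝ} (hμ : 0 < μ) {ε : ℝ}
    (hε : ε ∈ Set.Ioo 0 (epsBar Wr Wc)) {α : ℕ → ℝ} (hα0 : ∀ k, 0 ≤ α k)
    (x0 y0 : Fin n → EuclideanSpace ℝ (Fin m)) :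
    ∃ ρ A c : ℝ, 0 < ρ ∧ ρ < 1 ∧ ∀ (z : ℕ → Fin n → EuclideanSpace ℝ (Fin m)) k i,
      ‖consensusError (iter Wr Wc ε α μ f x0 y0 z k) i‖ ≤
        scalarRec ρ A (fun k => c * (α k * ∑ i, ‖z k i‖ ^ 2)) k := by
  have hn0 : n ≠ 0 := by omega
  obtain ⟨ρ, C, hρ0, hρ1, hC, hB⟩ := exists_geometric_bound (deflated Wr Wc ε)
    fun z hz v hv => deflated_eigenvector_eq_zero hn hG hWr hWr1 hWc hWc1 hε hz hv
  set Q : Matrix (Fin n ⊕ Fin n) (Fin n ⊕ Fin n) ℝ := 1 - consensusProj n with hQ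
  set q : ℝ := ∑ i, ∑ j, |Q i j| with hq
  have hQq : ∀ i j, |Q i j| ≤ q := fun i j =>
    (Finset.single_le_sum (f := fun j => |Q i j|) (fun j _ => abs_nonneg _)
      (Finset.mem_univ j)).trans
    (Finset.single_le_sum (f := fun i => ∑ j, |Q i j|)
      (fun i _ => Finset.sum_nonneg fun j _ => abs_nonneg _) (Finset.mem_univ i))
  have hq0 : 0 ≤ q := Finset.sum_nonneg fun i _ => Finset.sum_nonneg fun j _ => abs_nonneg _
  refine ⟨ρ, C * ∑ j, ‖deviation (m := m) (x0, y0) j‖,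
    C * (Fintype.card (Fin n ⊕ Fin n) * (q * D)), hρ0, hρ1, fun z k i => ?_⟩
  have hmain := norm_act_pow_le_scalarRec hB hρ0 hC hα0
    (e := fun k => deviation (iter Wr Wc ε α μ f x0 y0 z k))
    (g := fun k => act Q (Sum.elim
      (fun i => oracle (f i) μ ((iter Wr Wc ε α μ f x0 y0 z k).1 i) (z k i)) 0))
    (G := fun k => Fintype.card (Fin n ⊕ Fin n) * (q * (D * ∑ i, ‖z k i‖ ^ 2)))
    (fun k => deviation_iter_succ hn0 hWr1 hWc1 ε α μ f x0 y0 z k) (fun k => ?_) k 0 (Sum.inl i)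
  · rw [pow_zero, pow_zero, one_mul, act_one, deviation_inl] at hmain
    refine hmain.trans_eq ?_
    congr 1
    ext k
    ring
  · refine (Finset.sum_le_sum fun j _ => norm_act_le hQq _ j).trans ?_
    rw [Finset.sum_const, Finset.card_univ, nsmul_eq_mul]
    gcongr
    rw [Fintype.sum_sum_type, Finset.mul_sum]
    simp only [Sum.elim_inl, Sum.elim_inr, Pi.zero_apply, norm_zero, Finset.sum_const_zero,
      add_zero]
    exact Finset.sum_le_sum fun j _ => norm_oracle_le (hlip j) hμ _ _

end Deviation

/-! ### Moments and measurability -/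

section Probability

variable {n m : ℕ} {Ω : Type*} [MeasurableSpace Ω] {P : Measure Ω}

theorem ae_summable_of_summable_integral {F : ℕ → Ω → ℝ} (h0 : ∀ k ω, 0 ≤ F k ω)
    (hF : ∀ k, Integrable (F k) P) (hs : Summable fun k => ∫ ω, F k ω ∂P) :
    ∀ᵐ ω ∂P, Summable fun k => F k ω := by
  have hm : ∀ k, AEMeasurable (fun ω => ENNReal.ofReal (F k ω)) P := fun k =>
    (hF k).aestronglyMeasurable.aemeasurable.ennreal_ofReal
  have hfin : ∫⁻ ω, ∑' k, ENNReal.ofReal (F k ω) ∂P ≠ ⊤ := by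
    rw [lintegral_tsum hm]
    simp_rw [← ofReal_integral_eq_lintegral_ofReal (hF _) (ae_of_all _ (h0 _))]
    exact hs.tsum_ofReal_ne_top
  filter_upwards [ae_lt_top' (AEMeasurable.tsum hm) hfin] with ω hω
  have := ENNReal.summable_toReal hω.ne
  simpa only [ENNReal.toReal_ofReal (h0 _ ω)] using this

theorem integrable_norm_pow_of_hasLaw {X : Ω → EuclideanSpace ℝ (Fin m)}
    (hX : HasLaw X (stdGaussian (EuclideanSpace ℝ (Fin m))) P) {p : ℕ} (hp : p ≠ 0) :
    Integrable (fun ω => ‖X ω‖ ^ p) P ∧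
      ∫ ω, ‖X ω‖ ^ p ∂P = ∫ x, ‖x‖ ^ p ∂stdGaussian (EuclideanSpace ℝ (Fin m)) := by
  have hint : Integrable (fun x => ‖x‖ ^ p) (stdGaussian (EuclideanSpace ℝ (Fin m))) :=
    (IsGaussian.memLp_id (stdGaussian (EuclideanSpace ℝ (Fin m))) p
      (ENNReal.natCast_ne_top p)).integrable_norm_pow hp
  refine ⟨?_, hX.integral_comp hint.aestronglyMeasurable⟩
  rw [← hX.map_eq] at hint
  exact hint.comp_aemeasurable hX.aemeasurable

theorem continuous_of_abs_sub_le {f : EuclideanSpace ℝ (Fin m) → ℝ} {D : ℝ} (hD : 0 ≤ D)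
    (hf : ∀ x y, |f x - f y| ≤ D * ‖x - y‖) : Continuous f :=
  (LipschitzWith.of_dist_le_mul (K := ⟨D, hD⟩) fun x y => by
    rw [Real.dist_eq, dist_eq_norm]; exact hf x y).continuous

theorem aemeasurable_iter {f : Fin n → EuclideanSpace ℝ (Fin m) → ℝ} (hf : ∀ i, Continuous (f i))
    (Wr Wc : Matrix (Fin n) (Fin n) ℝ) (ε : ℝ) (α : ℕ → ℝ) (μ : ℝ)
    (x0 y0 : Fin n → EuclideanSpace ℝ (Fin m)) {ζ : ℕ → Fin n → Ω → EuclideanSpace ℝ (Fin m)}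
    (hζ : ∀ k i, AEMeasurable (ζ k i) P) (k : ℕ) :
    (∀ i, AEMeasurable (fun ω => (iter Wr Wc ε α μ f x0 y0 (fun l i => ζ l i ω) k).1 i) P) ∧
    ∀ i, AEMeasurable (fun ω => (iter Wr Wc ε α μ f x0 y0 (fun l i => ζ l i ω) k).2 i) P := by
  induction k with
  | zero => exact ⟨fun i => aemeasurable_const, fun i => aemeasurable_const⟩
  | succ k ih =>
    obtain ⟨hx, hy⟩ := ih
    have hor : ∀ i, AEMeasurable (fun ω => oracle (f i) μ
        ((iter Wr Wc ε α μ f x0 y0 (fun l i => ζ l i ω) k).1 i) (ζ k i ω)) P := fun i => by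
      unfold oracle
      have h1 := (hf i).measurable.comp_aemeasurable ((hx i).add ((hζ k i).const_smul μ))
      have h2 := (hf i).measurable.comp_aemeasurable (hx i)
      exact ((h1.sub h2).div_const μ).smul (hζ k i)
    refine ⟨fun i => ?_, fun i => ?_⟩
    · exact ((Finset.aemeasurable_fun_sum _ fun j _ => (hx j).const_smul (Wr i j)).add
        ((hy i).const_smul ε)).sub ((hor i).const_smul (α k))
    · exact (((hx i).sub (Finset.aemeasurable_fun_sum _ fun j _ => (hx j).const_smul (Wr i j))).add
        (Finset.aemeasurable_fun_sum _ fun j _ => (hy j).const_smul (Wc i j))).sub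
        ((hy i).const_smul ε)

theorem aemeasurable_consensusError
    {s : Ω → (Fin n → EuclideanSpace ℝ (Fin m)) × (Fin n → EuclideanSpace ℝ (Fin m))}
    (hx : ∀ i, AEMeasurable (fun ω => (s ω).1 i) P)
    (hy : ∀ i, AEMeasurable (fun ω => (s ω).2 i) P) (i : Fin n) :
    AEMeasurable (fun ω => consensusError (s ω) i) P := by
  unfold consensusError average
  exact (hx i).sub (((Finset.aemeasurable_fun_sum _ fun j _ => hx j).const_smul (1 / (n : ℝ))).add
    ((Finset.aemeasurable_fun_sum _ fun j _ => hy j).const_smul (1 / (n : ℝ))))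

theorem integrable_scalarRec [IsFiniteMeasure P] {ρ A : ℝ} {b : ℕ → Ω → ℝ}
    (hb : ∀ k, Integrable (b k) P) (k : ℕ) :
    Integrable (fun ω => scalarRec ρ A (fun k => b k ω) k) P := by
  induction k with
  | zero => exact integrable_const A
  | succ k ih => exact (ih.const_mul ρ).add (hb k)

theorem integral_scalarRec [IsProbabilityMeasure P] {ρ A : ℝ} {b : ℕ → Ω → ℝ}
    (hb : ∀ k, Integrable (b k) P) (k : ℕ) :
    ∫ ω, scalarRec ρ A (fun k => b k ω) k ∂P = scalarRec ρ A (fun k => ∫ ω, b k ω ∂P) k := by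
  induction k with
  | zero => simp [scalarRec]
  | succ k ih =>
    simp only [scalarRec]
    rw [integral_add ((integrable_scalarRec hb k).const_mul ρ) (hb k), integral_const_mul, ih]

end Probability

end GradFreeDGD

theorem theorem1
    {n m : ℕ} (hn : 2 ≤ n)
    -- the network: a strongly connected directed graph with all self-loops
    (G : Digraph (Fin n)) (hloop : ∀ i, G.Adj i i) (hG : GradFreeDGD.StronglyConnected G)
    -- the row-stochastic and the column-stochastic weight matrices
    (Wr Wc : Matrix (Fin n) (Fin n) ℝ)
    (hWr : GradFreeDGD.IsWeightMatrix G Wr) (hWr1 : GradFreeDGD.RowSumsOne Wr)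
    (hWc : GradFreeDGD.IsWeightMatrix G Wc) (hWc1 : GradFreeDGD.ColSumsOne Wc)
    -- the costs: uniformly Lipschitz local costs with convex sum
    (f : Fin n → EuclideanSpace ℝ (Fin m) → ℝ)
    (hconv : ConvexOn ℝ Set.univ (fun x => ∑ i, f i x))
    (hlip : ∃ D : ℝ, 0 < D ∧ ∀ i x y, |f i x - f i y| ≤ D * ‖x - y‖)
    -- the parameters
    (μ : ℝ) (hμ : 0 < μ)
    (ε : ℝ) (hε : ε ∈ Set.Ioo 0 (GradFreeDGD.epsBar Wr Wc))
    (α : ℕ → ℝ) (hα0 : ∀ k, 0 ≤ α k)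
    (hα1 : Tendsto (fun N => ∑ k ∈ Finset.range N, α k) atTop atTop)
    (hα2 : Summable (fun k => α k ^ 2))
    -- the random directions: standard Gaussian vectors
    {Ω : Type*} [MeasurableSpace Ω] (P : Measure Ω) [IsProbabilityMeasure P]
    (ζ : ℕ → Fin n → Ω → EuclideanSpace ℝ (Fin m))
    (hζ : ∀ k i, HasLaw (ζ k i) (stdGaussian (EuclideanSpace ℝ (Fin m))) P)
    -- the initial values and the states produced by the algorithm
    (x0 y0 : Fin n → EuclideanSpace ℝ (Fin m))
    (s : ℕ → Ω → (Fin n → EuclideanSpace ℝ (Fin m)) × (Fin n → EuclideanSpace ℝ (Fin m)))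
    (hs : ∀ k ω, s k ω = GradFreeDGD.iter Wr Wc ε α μ f x0 y0 (fun l i => ζ l i ω) k) :
    (∀ᵐ ω ∂P, Summable (fun k => α k * ∑ i, ‖GradFreeDGD.consensusError (s k ω) i‖)) ∧
    ∀ i, (∀ᵐ ω ∂P, Tendsto (fun k => GradFreeDGD.consensusError (s k ω) i) atTop (𝓝 0)) ∧
      (∀ k, Integrable (fun ω => GradFreeDGD.consensusError (s k ω) i) P) ∧
      Tendsto (fun k => ∫ ω, ‖GradFreeDGD.consensusError (s k ω) i‖ ∂P) atTop (𝓝 0) := by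
  obtain ⟨D, hD, hf⟩ := hlip
  obtain ⟨ρ, A, c, hρ0, hρ1, hbound⟩ := GradFreeDGD.exists_norm_consensusError_le hn hG hWr hWr1
    hWc hWc1 hf hμ hε hα0 x0 y0
  set b : ℕ → Ω → ℝ := fun k ω => c * (α k * ∑ i, ‖ζ k i ω‖ ^ 2) with hb
  have hle : ∀ k i ω, ‖GradFreeDGD.consensusError (s k ω) i‖ ≤
      GradFreeDGD.scalarRec ρ A (fun k => b k ω) k := fun k i ω => by
    rw [hs]; exact hbound (fun l i => ζ l i ω) k i
  have hbint : ∀ k, Integrable (b k) P := fun k =>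
    ((integrable_finsetSum _ fun i _ =>
      (GradFreeDGD.integrable_norm_pow_of_hasLaw (hζ k i) two_ne_zero).1).const_mul _).const_mul _
  -- The fourth moments of the directions make the scalar input square summable.
  have hbsq : ∀ᵐ ω ∂P, Summable fun k => b k ω ^ 2 := by
    have h4 : ∀ᵐ ω ∂P, ∀ i, Summable fun k => α k ^ 2 * ‖ζ k i ω‖ ^ 4 := by
      refine ae_all_iff.2 fun i => GradFreeDGD.ae_summable_of_summable_integral
        (fun k ω => by positivity) (fun k =>
          (GradFreeDGD.integrable_norm_pow_of_hasLaw (hζ k i) four_ne_zero).1.const_mul _) ?_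
      simp_rw [integral_const_mul,
        fun k => (GradFreeDGD.integrable_norm_pow_of_hasLaw (hζ k i) four_ne_zero).2]
      exact hα2.mul_right _
    filter_upwards [h4] with ω hω
    refine Summable.of_nonneg_of_le (fun k => sq_nonneg _) (fun k => ?_)
      ((summable_sum fun i (_ : i ∈ Finset.univ) => hω i).mul_left (c ^ 2 * n))
    have h := sq_sum_le_card_mul_sum_sq (s := (Finset.univ : Finset (Fin n)))
      (f := fun i => ‖ζ k i ω‖ ^ 2)
    rw [Finset.card_univ, Fintype.card_fin] at h
    calc b k ω ^ 2 = c ^ 2 * α k ^ 2 * (∑ i, ‖ζ k i ω‖ ^ 2) ^ 2 := by rw [hb]; ring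
      _ ≤ c ^ 2 * α k ^ 2 * (n * ∑ i, (‖ζ k i ω‖ ^ 2) ^ 2) :=
        mul_le_mul_of_nonneg_left h (by positivity)
      _ = c ^ 2 * n * ∑ i, α k ^ 2 * ‖ζ k i ω‖ ^ 4 := by
        rw [← Finset.mul_sum]
        simp only [← pow_mul]
        ring
  refine ⟨?_, fun i => ⟨?_, ?_, ?_⟩⟩
  · filter_upwards [hbsq] with ω hω
    have hu := GradFreeDGD.summable_scalarRec_sq (u₀ := A) hρ0.le hρ1 hω
    refine Summable.of_nonneg_of_le
      (fun k => mul_nonneg (hα0 k) (Finset.sum_nonneg fun i _ => norm_nonneg _)) (fun k => ?_)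
      ((hα2.add hu).mul_left (n : ℝ))
    have h1 : ∑ i, ‖GradFreeDGD.consensusError (s k ω) i‖ ≤
        n * GradFreeDGD.scalarRec ρ A (fun k => b k ω) k := by
      refine (Finset.sum_le_sum fun i _ => hle k i ω).trans_eq ?_
      rw [Finset.sum_const, Finset.card_univ, Fintype.card_fin, nsmul_eq_mul]
    refine (mul_le_mul_of_nonneg_left h1 (hα0 k)).trans ?_
    rw [mul_left_comm]
    refine mul_le_mul_of_nonneg_left ?_ (Nat.cast_nonneg n)
    nlinarith [sq_nonneg (α k - GradFreeDGD.scalarRec ρ A (fun k => b k ω) k), sq_nonneg (α k),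
      sq_nonneg (GradFreeDGD.scalarRec ρ A (fun k => b k ω) k)]
  · filter_upwards [hbsq] with ω hω
    exact squeeze_zero_norm (fun k => hle k i ω)
      (GradFreeDGD.tendsto_scalarRec hρ0.le hρ1 hω)
  · intro k
    refine (GradFreeDGD.integrable_scalarRec hbint k).mono' ?_ (ae_of_all _ fun ω => hle k i ω)
    have hmeas := GradFreeDGD.aemeasurable_iter
      (fun i => GradFreeDGD.continuous_of_abs_sub_le hD.le (hf i)) Wr Wc ε α μ x0 y0
      (fun k i => (hζ k i).aemeasurable) k
    simp only [hs]
    exact (GradFreeDGD.aemeasurable_consensusError hmeas.1 hmeas.2 i).aestronglyMeasurable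
  · refine squeeze_zero (fun k => integral_nonneg fun ω => norm_nonneg _)
      (fun k => (integral_mono_of_nonneg (ae_of_all _ fun ω => norm_nonneg _)
        (GradFreeDGD.integrable_scalarRec hbint k) (ae_of_all _ fun ω => hle k i ω)).trans_eq
        (GradFreeDGD.integral_scalarRec hbint k))
      (GradFreeDGD.tendsto_scalarRec hρ0.le hρ1 ?_)
    have hmean : ∀ k, ∫ ω, b k ω ∂P =
        c * (α k * (n * ∫ x, ‖x‖ ^ 2 ∂stdGaussian (EuclideanSpace ℝ (Fin m)))) := fun k => by
      rw [hb, integral_const_mul, integral_const_mul, integral_finsetSum _ fun i _ =>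
        (GradFreeDGD.integrable_norm_pow_of_hasLaw (hζ k i) two_ne_zero).1]
      simp only [(GradFreeDGD.integrable_norm_pow_of_hasLaw (hζ k _) two_ne_zero).2,
        Finset.sum_const, Finset.card_univ, Fintype.card_fin, nsmul_eq_mul]
    refine (hα2.mul_left ((c * (n * ∫ x, ‖x‖ ^ 2 ∂stdGaussian (EuclideanSpace ℝ (Fin m)))) ^ 2)).congr
      fun k => ?_
    rw [hmean]
    ring
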